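/- **Theorem 1.2.** For a unital C*-algebra $B$ let $U(B)$ be its unitary group with the norm topology, $U_B$ the connected component of $1$ in $U(B)$, $\mathrm{Aut}(B)$ the group of $*$-automorphisms of $B$ with the topology of pointwise norm convergence, and $$V_B:=\overline{\{\mathrm{Ad}(u)\mid u\in U_B\}}\subseteq \mathrm{Aut}(B),\qquad \mathrm{Ad}(u)(x)=uxu^*.$$ For a proper closed two-sided ideal $I\subseteq B$ let $\tilde I=I+\mathbb{C}1\subseteq B$ be its unitization, $U_I$ the connected component of $1$ in $U(\tilde I)$, and $V_I:=\overline{\{\mathrm{Ad}(u)\mid u\in U_I\}}\subseteq\mathrm{Aut}(B)$, a normal subgroup of $V_B$. Fix a free ultrafilter $\omega$ on $\mathbb{N}$. Let $\ell^\infty(B)$ be the C*-algebra of bounded sequences in $B$ and $$B_\omega=\ell^\infty(B)/\{(b_n)\mid \lim_{n\to\omega}\|b_n\|=0\}.$$ The central sequence algebra $B'\cap B_\omega$ is the commutant in $B_\omega$ of the image of $B$ under the diagonal embedding. A unital C*-algebra has stable rank one if its invertible elements are norm dense in it. Let $A$ be a separable unital C*-algebra and $I\subseteq A$ a proper closed two-sided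 ideal such that $U(\tilde I)$ is connected. Assume that $A'\cap A_\omega$ has stable rank one or that $U\big((A/I)'\cap (A/I)_\omega\big)$ is connected. Let $P\colon V_A\to V_{A/I}$ be the canonical homomorphism, $P(\phi)(a+I)=\phi(a)+I$. Then: 1. $\mathrm{Ker}(P)=V_I$; 2. $P=\tilde P\circ Q$, where $Q\colon V_A\to V_A/V_I$ is the quotient map ($V_A/V_I$ carrying the quotient topology) and $\tilde P\colon V_A/V_I\to V_{A/I}$ is a group homomorphism that is a homeomorphism onto its image. Moreover, $P$ is surjective: $P[V_A]=V_{A/I}$. -/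

import Mathlib

noncomputable section

open Filter Topology BoundedContinuousFunction

/-! ### The quotient of a unital C⋆-algebra by a closed two-sided ideal -/

namespace CStarQuotient

variable {A : Type*} [CStarAlgebra A]

/-- Approximate units of the ideal generated by `star y * y`, written as `1 - r`. -/
theorem exists_cutoff (I : Ideal A) {y : A} (hy : star y * y ∈ I) {ε : ℝ} (hε : 0 < ε) :
    ∃ r : A, IsSelfAdjoint r ∧ ‖r‖ ≤ 1 ∧ 1 - r ∈ I ∧ ‖y * r‖ ≤ ε := by
  obtain ⟨n, hn⟩ := exists_nat_gt (1 / ε ^ 2)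
  have hn0 : (0 : ℝ) < n := lt_trans (by positivity) hn
  set h := star y * y with hh
  have hsa : IsSelfAdjoint h := IsSelfAdjoint.star_mul_self y
  have hsp : ∀ x ∈ spectrum ℝ h, 0 ≤ x := spectrum_star_mul_self_nonneg
  have hne : ∀ x ∈ spectrum ℝ h, 1 + n * x ≠ 0 := fun x hx => by
    have := hsp x hx; positivity
  have hc : ContinuousOn (fun t : ℝ => (1 + n * t)⁻¹) (spectrum ℝ h) :=
    ContinuousOn.inv₀ (by fun_prop) hne
  set r := cfc (fun t : ℝ => (1 + n * t)⁻¹) h with hr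
  have hrsa : IsSelfAdjoint r := cfc_predicate _ _
  have hid : cfc (fun t : ℝ => t) h = h := cfc_id' ℝ h
  refine ⟨r, hrsa, ?_, ?_, ?_⟩
  · refine norm_cfc_le zero_le_one fun x hx => ?_
    have := hsp x hx
    rw [Real.norm_of_nonneg (by positivity)]
    exact inv_le_one_of_one_le₀ (by nlinarith)
  · have h1 : cfc (fun t : ℝ => (n * (1 + n * t)⁻¹) * t) h =
        cfc (fun t : ℝ => n * (1 + n * t)⁻¹) h * h := by
      rw [cfc_mul _ _ h (by fun_prop) (by fun_prop), hid]
    have h2 : 1 - r = cfc (fun t : ℝ => (n * (1 + n * t)⁻¹) * t) h := by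
      have h3 : cfc (fun _ : ℝ => (1 : ℝ)) h = 1 := cfc_const_one ℝ h
      rw [← h3, hr, ← cfc_sub _ _ h (by fun_prop) (by fun_prop)]
      refine cfc_congr fun x hx => ?_
      have := hne x hx
      field_simp
      ring
    rw [h2, h1]
    exact I.mul_mem_left _ hy
  · have h1 : star (y * r) * (y * r) = r * h * r := by
      rw [star_mul, hrsa.star_eq, hh]; simp only [mul_assoc]
    have h2 : r * h * r = cfc (fun t : ℝ => (1 + n * t)⁻¹ * t * (1 + n * t)⁻¹) h := by
      rw [cfc_mul _ _ h (by fun_prop) (by fun_prop), cfc_mul _ _ h (by fun_prop) (by fun_prop), hid]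
    have h3 : ‖y * r‖ * ‖y * r‖ ≤ ε * ε := by
      rw [← CStarRing.norm_star_mul_self, h1, h2]
      refine norm_cfc_le (by positivity) fun x hx => ?_
      have hx0 := hsp x hx
      rw [Real.norm_of_nonneg (by positivity)]
      have h4 : 1 < n * (ε * ε) := by
        rw [div_lt_iff₀ (by positivity)] at hn; nlinarith
      have h5 : (1 + n * x)⁻¹ * x * (1 + n * x)⁻¹ = x / ((1 + n * x) * (1 + n * x)) := by
        have := hne x hx; field_simp
      rw [h5, div_le_iff₀ (by positivity)]
      nlinarith [mul_nonneg hx0 hx0, mul_nonneg hx0 hn0.le, mul_pos hε hε,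
        mul_nonneg (mul_nonneg hx0 hn0.le) (mul_nonneg hx0 hn0.le), mul_nonneg hx0 (sub_nonneg.2 h4.le)]
    exact abs_le_of_sq_le_sq' (by nlinarith) hε.le |>.2

variable (I : Ideal A) [I.IsTwoSided] [hI : IsClosed (I : Set A)]

/-- A closed two-sided ideal of a C⋆-algebra is closed under the involution. -/
theorem star_mem {x : A} (hx : x ∈ I) : star x ∈ I := by
  have : star x ∈ closure (I : Set A) := by
    rw [Metric.mem_closure_iff]
    intro ε hε
    have hx' : star (star x) * star x ∈ I := by
      rw [star_star]; exact I.mul_mem_right _ hx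
    obtain ⟨r, -, -, h1, h2⟩ := exists_cutoff I hx' (half_pos hε)
    refine ⟨star x * (1 - r), I.mul_mem_left _ h1, ?_⟩
    rw [dist_eq_norm, mul_sub, mul_one, sub_sub_cancel]
    linarith
  rwa [hI.closure_eq] at this

/-- The involution `(a + I)⋆ = a⋆ + I` on `A ⧸ I`. -/
instance : Star (A ⧸ I) where
  star := Quotient.map' (s₁ := I.quotientRel) (s₂ := I.quotientRel) star fun a b hab => by
    rw [Submodule.quotientRel_def] at hab ⊢
    rw [← star_sub]
    exact star_mem I hab

theorem star_mk (a : A) : star (Ideal.Quotient.mk I a) = Ideal.Quotient.mk I (star a) := rfl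

theorem norm_mk_le (a : A) : ‖Ideal.Quotient.mk I a‖ ≤ ‖a‖ :=
  Submodule.Quotient.norm_mk_le I a

theorem exists_norm_lt (x : A ⧸ I) {ε : ℝ} (hε : 0 < ε) :
    ∃ a : A, Ideal.Quotient.mk I a = x ∧ ‖a‖ < ‖x‖ + ε :=
  Submodule.Quotient.norm_mk_lt x hε

instance : StarRing (A ⧸ I) where
  star_involutive x := by
    obtain ⟨a, rfl⟩ := Ideal.Quotient.mk_surjective x
    simp only [star_mk, star_star]
  star_mul x y := by
    obtain ⟨a, rfl⟩ := Ideal.Quotient.mk_surjective x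
    obtain ⟨b, rfl⟩ := Ideal.Quotient.mk_surjective y
    simp only [← map_mul, star_mk, star_mul]
  star_add x y := by
    obtain ⟨a, rfl⟩ := Ideal.Quotient.mk_surjective x
    obtain ⟨b, rfl⟩ := Ideal.Quotient.mk_surjective y
    simp only [← map_add, star_mk, star_add]

/-- The quotient norm `‖a + I‖ = inf {‖a + y‖ | y ∈ I}` makes `A ⧸ I` a normed ring. -/
instance : NormedRing (A ⧸ I) :=
  { (inferInstance : Ring (A ⧸ I)), Submodule.Quotient.normedAddCommGroup I with
    norm_mul_le := fun x y => by
      refine le_of_forall_pos_le_add fun ε hε => ?_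
      have hc : Tendsto (fun δ : ℝ => (‖x‖ + δ) * (‖y‖ + δ)) (𝓝[>] 0) (𝓝 (‖x‖ * ‖y‖)) := by
        have : Continuous fun δ : ℝ => (‖x‖ + δ) * (‖y‖ + δ) := by fun_prop
        simpa using (this.tendsto 0).mono_left nhdsWithin_le_nhds
      obtain ⟨δ, h1, h2⟩ := ((hc.eventually (gt_mem_nhds (lt_add_of_pos_right (‖x‖ * ‖y‖) hε))).and
        self_mem_nhdsWithin).exists
      obtain ⟨a, rfl, ha⟩ := exists_norm_lt I x h2
      obtain ⟨b, rfl, hb⟩ := exists_norm_lt I y h2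
      calc ‖Ideal.Quotient.mk I a * Ideal.Quotient.mk I b‖
          = ‖Ideal.Quotient.mk I (a * b)‖ := by rw [map_mul]
        _ ≤ ‖a * b‖ := norm_mk_le I _
        _ ≤ ‖a‖ * ‖b‖ := norm_mul_le _ _
        _ ≤ _ := by
          refine (mul_le_mul ha.le hb.le (norm_nonneg _) ?_).trans h1.le
          have : 0 < δ := h2
          positivity }

theorem norm_mk_le_norm_mul {a r : A} (hr : 1 - r ∈ I) : ‖Ideal.Quotient.mk I a‖ ≤ ‖a * r‖ := by
  have : Ideal.Quotient.mk I a = Ideal.Quotient.mk I (a * r) := by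
    rw [Ideal.Quotient.eq, show a - a * r = a * (1 - r) by rw [mul_sub, mul_one]]
    exact I.mul_mem_left _ hr
  rw [this]
  exact norm_mk_le I _

/-- The quotient of a unital C⋆-algebra by a closed two-sided ideal is a unital C⋆-algebra,
with the quotient norm and the involution `(a + I)⋆ = a⋆ + I`. -/
instance : CStarAlgebra (A ⧸ I) :=
  { (inferInstance : NormedRing (A ⧸ I)), (inferInstance : StarRing (A ⧸ I)),
    (inferInstance : Algebra ℂ (A ⧸ I)) with
    complete := (inferInstance : CompleteSpace (A ⧸ I)).complete
    norm_smul_le := (Submodule.Quotient.normedSpace I ℂ).norm_smul_le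
    star_smul := fun c x => by
      obtain ⟨a, rfl⟩ := Ideal.Quotient.mk_surjective x
      change Ideal.Quotient.mk I (star (c • a)) = star c • Ideal.Quotient.mk I (star a)
      rw [star_smul]
      rfl
    norm_mul_self_le := fun x => by
      refine le_of_forall_pos_le_add fun ε hε => ?_
      obtain ⟨a, rfl⟩ := Ideal.Quotient.mk_surjective x
      rw [star_mk, ← map_mul]
      obtain ⟨m, hm, hm'⟩ := exists_norm_lt I (Ideal.Quotient.mk I (star a * a)) (half_pos hε)
      have hy : star a * a - m ∈ I := (Ideal.Quotient.eq).1 hm.symm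
      obtain ⟨r, hr1, hr2, hr3, hr4⟩ :=
        exists_cutoff I (I.mul_mem_left (star (star a * a - m)) hy) (half_pos hε)
      calc ‖Ideal.Quotient.mk I a‖ * ‖Ideal.Quotient.mk I a‖
          ≤ ‖a * r‖ * ‖a * r‖ := by
            have := norm_mk_le_norm_mul I (a := a) hr3
            gcongr
        _ = ‖r * (star a * a * r)‖ := by
            rw [← CStarRing.norm_star_mul_self, star_mul, hr1.star_eq]; simp only [mul_assoc]
        _ ≤ ‖r‖ * ‖star a * a * r‖ := norm_mul_le _ _
        _ ≤ 1 * ‖star a * a * r‖ := by gcongr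
        _ = ‖m * r + (star a * a - m) * r‖ := by rw [one_mul, ← add_mul]; congr 2; abel
        _ ≤ ‖m * r‖ + ε / 2 := (norm_add_le _ _).trans (by gcongr)
        _ ≤ ‖m‖ * ‖r‖ + ε / 2 := by gcongr; exact norm_mul_le _ _
        _ ≤ ‖m‖ * 1 + ε / 2 := by gcongr
        _ ≤ _ := by linarith }

end CStarQuotient

namespace CStarQuotient

variable {A : Type*} [CStarAlgebra A] (I : Ideal A) [I.IsTwoSided] [hI : IsClosed (I : Set A)]


/-- The quotient map `π_I : A → A/I`. -/
def mkStar : A →⋆ₐ[ℂ] A ⧸ I :=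
  { Ideal.Quotient.mkₐ ℂ I with map_star' := fun _ => rfl }

@[simp] theorem mkStar_apply (a : A) : mkStar I a = Ideal.Quotient.mk I a := rfl

theorem continuous_mkStar : Continuous (mkStar I) :=
  AddMonoidHomClass.continuous_of_bound (mkStar I) 1 fun a => by
    rw [one_mul]; exact norm_mk_le I a

end CStarQuotient

/-! ### Automorphism groups and unitary groups -/

section Aut

variable {A : Type*} [CStarAlgebra A]

/-- The topology of pointwise norm convergence on `Aut(A)`. -/
instance : TopologicalSpace (A ≃⋆ₐ[ℂ] A) :=
  TopologicalSpace.induced (fun φ => (φ : A → A)) inferInstance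

theorem StarAlgEquiv.continuous_eval (a : A) : Continuous fun φ : A ≃⋆ₐ[ℂ] A => φ a :=
  (continuous_apply a).comp continuous_induced_dom

theorem StarAlgEquiv.continuous_iff_eval {X : Type*} [TopologicalSpace X] {f : X → (A ≃⋆ₐ[ℂ] A)} :
    Continuous f ↔ ∀ a, Continuous fun x => f x a := by
  rw [continuous_induced_rng, continuous_pi_iff]; rfl

theorem StarAlgEquiv.norm_apply_sub (φ : A ≃⋆ₐ[ℂ] A) (a b : A) : ‖φ a - φ b‖ = ‖a - b‖ := by
  rw [← map_sub, NonUnitalStarAlgHom.norm_map φ φ.injective]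

instance : IsTopologicalGroup (A ≃⋆ₐ[ℂ] A) where
  continuous_mul := by
    rw [StarAlgEquiv.continuous_iff_eval]
    intro a
    rw [continuous_iff_continuousAt]
    rintro ⟨φ, ψ⟩
    have h1 : Tendsto (fun p : (A ≃⋆ₐ[ℂ] A) × (A ≃⋆ₐ[ℂ] A) => p.1 (ψ a)) (𝓝 (φ, ψ))
        (𝓝 (φ (ψ a))) := ((StarAlgEquiv.continuous_eval (ψ a)).comp continuous_fst).tendsto _
    have h2 : Tendsto (fun p : (A ≃⋆ₐ[ℂ] A) × (A ≃⋆ₐ[ℂ] A) => p.1 (p.2 a) - p.1 (ψ a))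
        (𝓝 (φ, ψ)) (𝓝 0) := by
      rw [tendsto_zero_iff_norm_tendsto_zero]
      simp only [StarAlgEquiv.norm_apply_sub]
      have := (((StarAlgEquiv.continuous_eval a).comp continuous_snd).sub
        (continuous_const (y := ψ a))).norm.tendsto (φ, ψ)
      simpa using this
    have := h2.add h1
    simpa [ContinuousAt] using this
  continuous_inv := by
    rw [StarAlgEquiv.continuous_iff_eval]
    intro a
    rw [continuous_iff_continuousAt]
    intro φ
    rw [ContinuousAt, tendsto_iff_norm_sub_tendsto_zero]
    have : ∀ ψ : A ≃⋆ₐ[ℂ] A, ‖ψ⁻¹ a - φ⁻¹ a‖ = ‖ψ (φ⁻¹ a) - φ (φ⁻¹ a)‖ := fun ψ => by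
      rw [← StarAlgEquiv.norm_apply_sub ψ, norm_sub_rev]
      congr 2
      · rw [← StarAlgEquiv.mul_apply, ← StarAlgEquiv.mul_apply]; simp
    simp only [this]
    have := ((StarAlgEquiv.continuous_eval (φ⁻¹ a)).sub
      (continuous_const (y := φ (φ⁻¹ a)))).norm.tendsto φ
    simpa using this

end Aut

namespace ApproxInner

open CStarQuotient

/-- The homomorphism `U(A) → U(B)` induced by a unital ⋆-homomorphism `A → B`. -/
def unitaryMap {A B : Type*} [Ring A] [StarRing A] [Algebra ℂ A] [Ring B] [StarRing B]
    [Algebra ℂ B] (f : A →⋆ₐ[ℂ] B) : unitary A →* unitary B where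
  toFun u := ⟨f u, Unitary.map_mem f u.2⟩
  map_one' := Subtype.ext (map_one f)
  map_mul' u v := Subtype.ext (map_mul f (u : A) (v : A))

section VA

variable (A : Type*) [CStarAlgebra A]

/-- `U_A`, the connected component of the identity in the unitary group `U(A)`. -/
def unitaryComponent : Subgroup (unitary A) := Subgroup.connectedComponentOfOne (unitary A)

/-- `V_A`, the closure of `{Ad(u) | u ∈ U_A}` in `Aut(A)`. -/
def V : Subgroup (A ≃⋆ₐ[ℂ] A) :=
  ((unitaryComponent A).map (Unitary.conjStarAlgAut ℂ A)).topologicalClosure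

end VA

section Ideal

variable {A : Type*} [CStarAlgebra A] (I : Ideal A) [I.IsTwoSided] [hI : IsClosed (I : Set A)]

/-- The unitization `Ĩ = I + ℂ1 ⊆ A` of a proper closed two-sided ideal `I` (as `1 ∉ I`, the sum
is direct). -/
def unitization : StarSubalgebra ℂ A where
  carrier := {a | ∃ c : ℂ, a - algebraMap ℂ A c ∈ I}
  mul_mem' := by
    rintro a b ⟨c, hc⟩ ⟨d, hd⟩
    refine ⟨c * d, ?_⟩
    have : a * b - algebraMap ℂ A (c * d) =
        (a - algebraMap ℂ A c) * b + algebraMap ℂ A c * (b - algebraMap ℂ A d) := by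
      rw [map_mul]; noncomm_ring
    rw [this]
    exact I.add_mem (I.mul_mem_right _ hc) (I.mul_mem_left _ hd)
  add_mem' := by
    rintro a b ⟨c, hc⟩ ⟨d, hd⟩
    refine ⟨c + d, ?_⟩
    rw [map_add, add_sub_add_comm]
    exact I.add_mem hc hd
  algebraMap_mem' c := ⟨c, by simp⟩
  star_mem' := by
    rintro a ⟨c, hc⟩
    refine ⟨star c, ?_⟩
    rw [algebraMap_star_comm, ← star_sub]
    exact star_mem I hc

theorem mem_unitization {a : A} : a ∈ unitization I ↔ ∃ c : ℂ, a - algebraMap ℂ A c ∈ I := Iff.rfl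

/-- `U_I`, the connected component of the identity in `U(Ĩ)`, as a subgroup of `U(A)`. -/
def idealUnitaryComponent : Subgroup (unitary A) :=
  (Subgroup.connectedComponentOfOne (unitary (unitization I))).map
    (unitaryMap (unitization I).subtype)

/-- `V_I`, the closure of `{Ad(u) | u ∈ U_I}` in `Aut(A)`. -/
def idealV : Subgroup (A ≃⋆ₐ[ℂ] A) :=
  ((idealUnitaryComponent I).map (Unitary.conjStarAlgAut ℂ A)).topologicalClosure

theorem idealV_le_V : idealV I ≤ V A := by
  refine Subgroup.topologicalClosure_mono (Subgroup.map_mono ?_)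
  rintro _ ⟨u, hu, rfl⟩
  have hc : Continuous (unitaryMap (unitization I).subtype) :=
    (continuous_subtype_val.comp continuous_subtype_val).subtype_mk _
  have := hc.image_connectedComponent_subset 1 ⟨u, hu, rfl⟩
  rwa [map_one] at this

/-- Automorphisms in `V_A` preserve every closed two-sided ideal. -/
theorem map_mem_of_mem_V {φ : A ≃⋆ₐ[ℂ] A} (hφ : φ ∈ V A) {x : A} (hx : x ∈ I) : φ x ∈ I := by
  have hcl : IsClosed {ψ : A ≃⋆ₐ[ℂ] A | ψ x ∈ I} :=
    hI.preimage (StarAlgEquiv.continuous_eval x)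
  have hsub : (((unitaryComponent A).map (Unitary.conjStarAlgAut ℂ A) :
      Subgroup (A ≃⋆ₐ[ℂ] A)) : Set (A ≃⋆ₐ[ℂ] A)) ⊆ {ψ : A ≃⋆ₐ[ℂ] A | ψ x ∈ I} := by
    rintro _ ⟨u, -, rfl⟩
    exact I.mul_mem_right _ (I.mul_mem_left _ hx)
  exact closure_minimal hsub hcl hφ

/-- Conjugation by an automorphism of `A` preserving `I` leaves `{Ad(u) | u ∈ U_I}` invariant. -/
theorem conj_mem_map {φ ψ : A ≃⋆ₐ[ℂ] A} (hφ : ∀ x ∈ I, φ x ∈ I)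
    (hψ : ψ ∈ (idealUnitaryComponent I).map (Unitary.conjStarAlgAut ℂ A)) :
    φ * ψ * φ⁻¹ ∈ (idealUnitaryComponent I).map (Unitary.conjStarAlgAut ℂ A) := by
  obtain ⟨_, ⟨u, hu, rfl⟩, rfl⟩ := hψ
  have hmem : ∀ a ∈ unitization I, φ a ∈ unitization I := by
    rintro a ⟨c, hc⟩
    refine ⟨c, ?_⟩
    have := hφ _ hc
    rwa [map_sub, AlgHomClass.commutes φ] at this
  let f : unitary (unitization I) → unitary (unitization I) := fun w =>
    ⟨⟨φ w, hmem _ w.1.2⟩, by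
      have h1 : star ((w : unitization I) : A) * ((w : unitization I) : A) = 1 :=
        congrArg Subtype.val w.2.1
      have h2 : ((w : unitization I) : A) * star ((w : unitization I) : A) = 1 :=
        congrArg Subtype.val w.2.2
      constructor <;> apply Subtype.ext
      · change star (φ _) * φ _ = 1
        rw [← map_star, ← map_mul, h1, map_one]
      · change φ _ * star (φ _) = 1
        rw [← map_star, ← map_mul, h2, map_one]⟩
  have hφc : Continuous φ := (NonUnitalStarAlgHom.isometry φ φ.injective).continuous
  have hf : Continuous f :=
    ((hφc.comp (continuous_subtype_val.comp continuous_subtype_val)).subtype_mk _).subtype_mk _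
  have hf1 : f 1 = 1 := Subtype.ext (Subtype.ext (map_one φ))
  have h := hf.image_connectedComponent_subset 1 ⟨u, hu, rfl⟩
  rw [hf1] at h
  refine ⟨_, ⟨f u, h, rfl⟩, ?_⟩
  ext x
  change φ _ * x * star (φ _) = φ (_ * φ⁻¹ x * star _)
  rw [map_mul, map_mul, ← map_star, ← StarAlgEquiv.mul_apply φ φ⁻¹, mul_inv_cancel]
  rfl

/-- `V_I` is a normal subgroup of `V_A`. -/
instance idealV_normal : ((idealV I).subgroupOf (V A)).Normal where
  conj_mem := by
    rintro ⟨ψ, hψA⟩ hψ ⟨φ, hφ⟩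
    rw [Subgroup.mem_subgroupOf] at hψ ⊢
    have hc : Continuous fun χ : A ≃⋆ₐ[ℂ] A => φ * χ * φ⁻¹ := by fun_prop
    change φ * ψ * φ⁻¹ ∈ idealV I
    exact map_mem_closure (f := fun χ : A ≃⋆ₐ[ℂ] A => φ * χ * φ⁻¹) hc hψ fun χ hχ => conj_mem_map I (fun x hx => map_mem_of_mem_V I hφ hx) hχ

/-- The endomorphism `a + I ↦ φ(a) + I` of `A/I`. -/
def quotientHom (φ : A ≃⋆ₐ[ℂ] A) (hφ : ∀ x ∈ I, φ x ∈ I) : A ⧸ I →⋆ₐ[ℂ] A ⧸ I :=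
  { Ideal.Quotient.liftₐ I ((mkStar I).comp (φ : A →⋆ₐ[ℂ] A)).toAlgHom
      (fun a ha => (Ideal.Quotient.eq_zero_iff_mem).2 (hφ a ha)) with
    map_star' := by
      intro x
      obtain ⟨a, rfl⟩ := Ideal.Quotient.mk_surjective x
      exact congrArg (Ideal.Quotient.mk I) (map_star φ a) }

theorem quotientHom_mk (φ : A ≃⋆ₐ[ℂ] A) (hφ : ∀ x ∈ I, φ x ∈ I) (a : A) :
    quotientHom I φ hφ (Ideal.Quotient.mk I a) = Ideal.Quotient.mk I (φ a) := rfl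

/-- The automorphism `a + I ↦ φ(a) + I` of `A/I` induced by `φ ∈ V_A`. -/
def quotientAut (φ : V A) : (A ⧸ I) ≃⋆ₐ[ℂ] (A ⧸ I) :=
  StarAlgEquiv.ofBijective (quotientHom I φ.1 fun _ hx => map_mem_of_mem_V I φ.2 hx) <| by
    constructor
    · rw [injective_iff_map_eq_zero]
      intro x hx
      obtain ⟨a, rfl⟩ := Ideal.Quotient.mk_surjective x
      rw [quotientHom_mk, Ideal.Quotient.eq_zero_iff_mem] at hx
      have := map_mem_of_mem_V I (inv_mem φ.2) hx
      rw [← StarAlgEquiv.mul_apply, inv_mul_cancel] at this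
      exact (Ideal.Quotient.eq_zero_iff_mem).2 this
    · intro x
      obtain ⟨a, rfl⟩ := Ideal.Quotient.mk_surjective x
      refine ⟨Ideal.Quotient.mk I (φ.1⁻¹ a), ?_⟩
      rw [quotientHom_mk, ← StarAlgEquiv.mul_apply, mul_inv_cancel]
      rfl

theorem quotientAut_mk (φ : V A) (a : A) :
    quotientAut I φ (Ideal.Quotient.mk I a) = Ideal.Quotient.mk I (φ.1 a) := rfl

theorem continuous_quotientAut : Continuous (quotientAut I) := by
  rw [StarAlgEquiv.continuous_iff_eval]
  intro x
  obtain ⟨a, rfl⟩ := Ideal.Quotient.mk_surjective x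
  exact (continuous_mkStar I).comp ((StarAlgEquiv.continuous_eval a).comp continuous_subtype_val)

theorem quotientAut_mem (φ : V A) : quotientAut I φ ∈ V (A ⧸ I) := by
  have hdense : φ ∈ closure {ψ : V A | ψ.1 ∈ (unitaryComponent A).map (Unitary.conjStarAlgAut ℂ A)} := by
    rw [closure_subtype]
    refine closure_mono ?_ φ.2
    intro ψ hψ
    exact ⟨⟨ψ, Subgroup.le_topologicalClosure _ hψ⟩, hψ, rfl⟩
  refine map_mem_closure (continuous_quotientAut I) hdense ?_
  rintro ⟨_, h⟩ ⟨u, hu, rfl⟩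
  have hc : Continuous (unitaryMap (mkStar I)) :=
    ((continuous_mkStar I).comp continuous_subtype_val).subtype_mk _
  have h1 := hc.image_connectedComponent_subset 1 ⟨u, hu, rfl⟩
  rw [map_one] at h1
  refine ⟨_, h1, ?_⟩
  ext x
  obtain ⟨a, rfl⟩ := Ideal.Quotient.mk_surjective x
  rfl

/-- The canonical map `P : V_A → V_{A/I}`, `P(φ)(a + I) = φ(a) + I`. -/
def P : V A →* V (A ⧸ I) where
  toFun φ := ⟨quotientAut I φ, quotientAut_mem I φ⟩
  map_one' := by
    apply Subtype.ext
    ext x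
    obtain ⟨a, rfl⟩ := Ideal.Quotient.mk_surjective x
    rfl
  map_mul' φ ψ := by
    apply Subtype.ext
    ext x
    obtain ⟨a, rfl⟩ := Ideal.Quotient.mk_surjective x
    rfl

theorem P_apply_mk (φ : V A) (a : A) :
    (P I φ).1 (Ideal.Quotient.mk I a) = Ideal.Quotient.mk I (φ.1 a) := rfl

end Ideal

/-! ### Ultrapowers and central sequence algebras -/

section Ultrapower

variable (ω : Ultrafilter ℕ) (A : Type*) [CStarAlgebra A]

/-- The ideal `c_ω(A)` of `ℓ^∞(A)`, the C⋆-algebra of bounded sequences in `A` with the supremum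
norm (bounded functions on the discrete space `ℕ`). -/
def cIdeal : Ideal (ℕ →ᵇ A) where
  carrier := {a | Tendsto (fun n => ‖a n‖) ω (𝓝 0)}
  zero_mem' := by simp
  add_mem' := by
    intro a b ha hb
    refine squeeze_zero (fun _ => norm_nonneg _) (fun n => norm_add_le (a n) (b n)) ?_
    simpa using Tendsto.add ha hb
  smul_mem' := by
    intro c a ha
    refine squeeze_zero (g := fun n => ‖c‖ * ‖a n‖) (fun _ => norm_nonneg _) (fun n => ?_) ?_
    · exact (norm_mul_le (c n) (a n)).trans (by gcongr; exact c.norm_coe_le_norm n)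
    · simpa using Tendsto.const_mul ‖c‖ ha

theorem mem_cIdeal {a : ℕ →ᵇ A} : a ∈ cIdeal ω A ↔ Tendsto (fun n => ‖a n‖) ω (𝓝 0) := Iff.rfl

instance : (cIdeal ω A).IsTwoSided where
  mul_mem_of_left := by
    intro a c ha
    refine squeeze_zero (g := fun n => ‖a n‖ * ‖c‖) (fun _ => norm_nonneg _) (fun n => ?_) ?_
    · exact (norm_mul_le (a n) (c n)).trans (by gcongr; exact c.norm_coe_le_norm n)
    · simpa using Tendsto.mul_const ‖c‖ ha

instance : IsClosed (cIdeal ω A : Set (ℕ →ᵇ A)) := by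
  refine isClosed_of_closure_subset fun a ha => ?_
  change Tendsto (fun n => ‖a n‖) ω (𝓝 0)
  rw [Metric.tendsto_nhds]
  intro ε hε
  obtain ⟨b, hb, hab⟩ := Metric.mem_closure_iff.1 ha (ε / 2) (half_pos hε)
  filter_upwards [Metric.tendsto_nhds.1 hb (ε / 2) (half_pos hε)] with n hn
  simp only [dist_zero_right, norm_norm] at hn ⊢
  rw [dist_eq_norm] at hab
  have h1 : ‖a n - b n‖ ≤ ‖a - b‖ := (a - b).norm_coe_le_norm n
  have h2 := norm_add_le (a n - b n) (b n)
  rw [sub_add_cancel] at h2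
  linarith

/-- The ultrapower `A_ω = ℓ^∞(A) / c_ω(A)`. -/
abbrev Ultrapower : Type _ := (ℕ →ᵇ A) ⧸ cIdeal ω A

/-- The diagonal embedding `A → A_ω`, `a ↦ (a, a, …) + c_ω(A)`. -/
def diagonal : A →⋆ₐ[ℂ] Ultrapower ω A :=
  (mkStar (cIdeal ω A)).comp
    { toFun := BoundedContinuousFunction.const ℕ
      map_one' := rfl
      map_mul' := fun _ _ => by ext; rfl
      map_zero' := rfl
      map_add' := fun _ _ => by ext; rfl
      commutes' := fun _ => rfl
      map_star' := fun _ => by ext; rfl }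

theorem diagonal_apply (a : A) :
    diagonal ω A a = Ideal.Quotient.mk (cIdeal ω A) (BoundedContinuousFunction.const ℕ a) := rfl

/-- The central sequence algebra `A' ∩ A_ω`: the commutant of the image of `A` in `A_ω`. -/
def centralSequenceAlgebra : StarSubalgebra ℂ (Ultrapower ω A) :=
  StarSubalgebra.centralizer ℂ (Set.range (diagonal ω A))

theorem mem_centralSequenceAlgebra {x : Ultrapower ω A} :
    x ∈ centralSequenceAlgebra ω A ↔ ∀ a : A, diagonal ω A a * x = x * diagonal ω A a := by
  rw [centralSequenceAlgebra, StarSubalgebra.mem_centralizer_iff]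
  constructor
  · intro h a
    exact (h _ ⟨a, rfl⟩).1
  · rintro h _ ⟨a, rfl⟩
    exact ⟨h a, by rw [← map_star]; exact h (star a)⟩

end Ultrapower

/-- A unital C⋆-algebra has stable rank one if its invertible elements are (norm) dense in it. -/
def HasStableRankOne (B : Type*) [Ring B] [TopologicalSpace B] : Prop :=
  Dense {x : B | IsUnit x}

end ApproxInner

end

/-!
Write `B = A/I` and `π` for the quotient map. Everything follows from one lifting property
(`exists_lift_almost_commuting`): a unitary of `U_B` that almost commutes with the image of a
suitable finite set has a lift in `U_A` that almost commutes with a prescribed finite set.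

**The lifting property.** Otherwise, counterexamples for finer and finer data form a unitary `u` of
`B' ∩ B_ω`. The map `A' ∩ A_ω → B' ∩ B_ω` is onto (`centralMap_surjective`): a central sequence of
`B` is lifted termwise and multiplied by elements `rₙ ∈ 1 - I` of a quasi-central approximate unit.
Such elements are produced by averaging (`exists_sum_cutoff`): choosing `r₁, r₂, …` so that the
commutators `[x, rᵢ]` are almost orthogonal makes `‖[x, r₁ + ⋯ + rₙ]‖` of order `√n`. If
`A' ∩ A_ω` has stable rank one, `u` lifts to a unitary because a lift can be perturbed to an
invertible element, whose unitary polar part lifts `u` up to a unitary near `1`. If `U(B' ∩ B_ω)` is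
connected, `u` lifts because the liftable unitaries form an open subgroup. Unitaries near `1` always
lift, by the open mapping theorem. A unitary lift of `u` is represented by unitaries of `A` that
lift almost all terms exactly (`exists_unitary_lift_near`). They lie in `U_A`: by
`exists_lift_unitaryComponent` each term also has a lift in `U_A`, and two lifts differ by an
element of `U(Ĩ)`, which is connected.

**Consequences.** Let `φ ∈ V_A` be close to `Ad(u)` on a finite set, with `u ∈ U_A`, and let `P(φ)` be
close to the identity. Then `π(u)` almost commutes with a finite set, so `π(u) = π(v)` for some
`v ∈ U_A` that almost commutes with a given finite set. As `u v⁻¹ ∈ U_I`, the automorphism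
`Ad(u v⁻¹)` of `V_I` approximates `φ`. This gives `Ker(P) ⊆ V_I` (`ker_P`), and, as
`Ad(v u⁻¹) φ` is close to the identity and has the same image as `φ`, that `P` is open onto its image
(`exists_small_lift_of_P_small`). The image is dense, since `U_A → U_B` is onto. Surjectivity is
then a property of completely metrizable groups
(`MonoidHom.surjective_of_denseRange_of_almost_open`), proved by successive approximation of an
element of `V_B` by products `P(θₙ) P(κₙ)⁻¹` whose two factors are corrected in turn.
-/

noncomputable section

open Filter Topology BoundedContinuousFunction

/-! ### Unitary polar parts -/

namespace CStarAlgebra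

variable {C D : Type*} [CStarAlgebra C] [CStarAlgebra D]

/-- The unitary part `a (a⋆a)^{-1/2}` of the polar decomposition of an invertible element `a`.
(For other elements the functional calculus may return a junk value.) -/
def polarPart (a : C) : C := a * cfc (fun t : ℝ => (√t)⁻¹) (star a * a)

theorem pos_of_mem_spectrum_star_mul_self {a : C} (ha : IsUnit a) {t : ℝ}
    (ht : t ∈ spectrum ℝ (star a * a)) : 0 < t := by
  refine lt_of_le_of_ne (spectrum_star_mul_self_nonneg t ht) ?_
  rintro rfl
  exact spectrum.zero_notMem ℝ (ha.star.mul ha) ht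

theorem continuousOn_inv_sqrt {a : C} (ha : IsUnit a) :
    ContinuousOn (fun t : ℝ => (√t)⁻¹) (spectrum ℝ (star a * a)) :=
  ContinuousOn.inv₀ (by fun_prop) fun _ ht =>
    (Real.sqrt_pos.2 (pos_of_mem_spectrum_star_mul_self ha ht)).ne'

theorem polarPart_mem_unitary {a : C} (ha : IsUnit a) : polarPart a ∈ unitary C := by
  have hc := continuousOn_inv_sqrt ha
  set h := cfc (fun t : ℝ => (√t)⁻¹) (star a * a) with hh
  have hsa : star h = h := (cfc_predicate (R := ℝ) _ _ : IsSelfAdjoint h).star_eq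
  have hid : cfc (fun t : ℝ => t) (star a * a) = star a * a :=
    cfc_id' ℝ _ (IsSelfAdjoint.star_mul_self a)
  have h1 : h * (star a * a) * h = 1 := by
    rw [← hid, hh, ← cfc_mul _ _ _ hc (by fun_prop), ← cfc_mul _ _ _ (by fun_prop) hc,
      ← cfc_const_one ℝ (star a * a) (IsSelfAdjoint.star_mul_self a)]
    refine cfc_congr fun t ht => ?_
    have ht := pos_of_mem_spectrum_star_mul_self ha ht
    have h2 := (Real.sqrt_pos.2 ht).ne'
    have h3 := Real.mul_self_sqrt ht.le
    field_simp
    nlinarith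
  have h2 : IsUnit h := by
    rw [hh]
    exact (isUnit_cfc_iff _ _ hc (IsSelfAdjoint.star_mul_self a)).2 fun t ht =>
      (inv_pos.2 (Real.sqrt_pos.2 (pos_of_mem_spectrum_star_mul_self ha ht))).ne'
  have h3 : star (a * h) * (a * h) = 1 := by
    rw [star_mul, hsa, ← h1]; simp only [mul_assoc]
  exact ⟨h3, (ha.mul h2).mul_left_injective
    (show a * h * star (a * h) * (a * h) = 1 * (a * h) by rw [mul_assoc, h3, mul_one, one_mul])⟩

theorem norm_polarPart_sub_le {a : C} (h : ‖star a * a - 1‖ ≤ 1 / 2) :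
    ‖polarPart a - a‖ ≤ ‖a‖ * ‖star a * a - 1‖ := by
  nontriviality C
  have hs : ∀ t ∈ spectrum ℝ (star a * a), |t - 1| ≤ ‖star a * a - 1‖ := by
    intro t ht
    have : t - 1 ∈ spectrum ℝ (star a * a - 1) := by
      have := spectrum.sub_singleton_eq (star a * a) (1 : ℝ)
      rw [map_one] at this
      rw [← this]
      exact ⟨t, ht, 1, rfl, rfl⟩
    exact spectrum.norm_le_norm_of_mem this
  have hpos : ∀ t ∈ spectrum ℝ (star a * a), 1 / 2 ≤ t := fun t ht => by
    have := (abs_le.1 ((hs t ht).trans h)).1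
    linarith
  have hc : ContinuousOn (fun t : ℝ => (√t)⁻¹) (spectrum ℝ (star a * a)) :=
    ContinuousOn.inv₀ (by fun_prop) fun t ht =>
      (Real.sqrt_pos.2 (by linarith [hpos t ht])).ne'
  have h1 : polarPart a - a = a * cfc (fun t : ℝ => (√t)⁻¹ - 1) (star a * a) := by
    rw [polarPart, cfc_sub _ _ _ hc (by fun_prop),
      cfc_const_one ℝ (star a * a) (IsSelfAdjoint.star_mul_self a), mul_sub, mul_one]
  rw [h1]
  refine (norm_mul_le _ _).trans (mul_le_mul_of_nonneg_left ?_ (norm_nonneg _))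
  refine norm_cfc_le (norm_nonneg _) fun t ht => (le_trans ?_ (hs t ht))
  -- `|t^{-1/2} - 1| = |1 - t| / (√t + t)`, and the denominator is at least `1` for `t ≥ 1/2`.
  have h2 := hpos t ht
  have h3 : (1 : ℝ) / 2 ≤ √t := Real.le_sqrt_of_sq_le (by norm_num; linarith)
  have h4 : √t * √t = t := Real.mul_self_sqrt (by linarith)
  have h5 : (√t)⁻¹ - 1 = (1 - t) / (√t + t) := by
    have : √t ≠ 0 := by linarith
    have h6 : √t + t ≠ 0 := by linarith
    field_simp
    nlinarith
  rw [h5, Real.norm_eq_abs, abs_div, abs_sub_comm, abs_of_pos (a := √t + t) (by linarith)]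
  exact div_le_self (abs_nonneg _) (by linarith)

theorem polarPart_unitary_mul (u : unitary C) (a : C) :
    polarPart ((u : C) * a) = u * polarPart a := by
  have : star ((u : C) * a) * (u * a) = star a * a := by
    rw [star_mul, mul_assoc, ← mul_assoc (star (u : C)), Unitary.coe_star_mul_self, one_mul]
  rw [polarPart, this, polarPart, mul_assoc]

theorem map_polarPart (f : C →⋆ₐ[ℂ] D) {a : C} (ha : IsUnit a) :
    f (polarPart a) = polarPart (f a) := by
  have : f (cfc (fun t : ℝ => (√t)⁻¹) (star a * a)) = cfc (fun t : ℝ => (√t)⁻¹) (f (star a * a)) :=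
    StarAlgHomClass.map_cfc (S := ℂ) f _ _ (continuousOn_inv_sqrt ha) (map_continuous f)
      (IsSelfAdjoint.star_mul_self a) (by rw [map_mul, map_star]; exact IsSelfAdjoint.star_mul_self _)
  rw [polarPart, map_mul, this, map_mul, map_star, polarPart]

theorem norm_star_mul_self_sub_one_le {b : C} {η : ℝ} (h : ‖b - 1‖ ≤ η) (hη : η ≤ 1 / 6) :
    ‖star b * b - 1‖ ≤ 3 * η := by
  have h0 : 0 ≤ η := (norm_nonneg _).trans h
  have h1 : star b * b - 1 = star (b - 1) * (b - 1) + star (b - 1) + (b - 1) := by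
    rw [star_sub, star_one]; noncomm_ring
  have h2 : ‖star (b - 1) * (b - 1)‖ ≤ η * η := by
    rw [CStarRing.norm_star_mul_self]; gcongr
  have h3 : ‖star (b - 1)‖ ≤ η := by rwa [norm_star]
  rw [h1]
  refine (norm_add₃_le).trans ?_
  nlinarith

theorem norm_polarPart_sub_one_le {b : C} {η : ℝ} (h : ‖b - 1‖ ≤ η) (hη : η ≤ 1 / 6) :
    ‖polarPart b - 1‖ ≤ 7 * η := by
  have h0 : 0 ≤ η := (norm_nonneg _).trans h
  rcases subsingleton_or_nontrivial C with hC | hC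
  · rw [Subsingleton.elim (polarPart b - 1) 0, norm_zero]
    positivity
  have h1 := norm_star_mul_self_sub_one_le h hη
  have h2 := norm_polarPart_sub_le (h1.trans (by linarith))
  have h3 : ‖b‖ ≤ 2 := by
    have := norm_add_le (b - 1) 1
    rw [sub_add_cancel, norm_one] at this
    linarith
  have h4 : ‖polarPart b - b‖ ≤ 2 * (3 * η) :=
    h2.trans (mul_le_mul h3 h1 (norm_nonneg _) (by norm_num))
  have h5 := norm_add_le (polarPart b - b) (b - 1)
  rw [sub_add_sub_cancel] at h5
  linarith

theorem isUnit_of_norm_sub_one_lt {b : C} (h : ‖b - 1‖ < 1) : IsUnit b := by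
  have := isUnit_one_sub_of_norm_lt_one (x := 1 - b) (by rwa [norm_sub_rev])
  rwa [sub_sub_cancel] at this

/-! ### Lifting unitaries -/

/-- Unitaries near `1` lift to unitaries near `1`: a lift close to `1` exists by the open mapping
theorem, and its polar part is still a lift. -/
theorem exists_unitary_lift_near_one (f : C →⋆ₐ[ℂ] D) (hf : Function.Surjective f) {ε : ℝ}
    (hε : 0 < ε) : ∃ δ > 0, ∀ u : unitary D, ‖(u : D) - 1‖ < δ →
      ∃ v : unitary C, f v = u ∧ ‖(v : C) - 1‖ < ε := by
  let g : C →L[ℂ] D := ⟨f.toAlgHom.toLinearMap, map_continuous f⟩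
  obtain ⟨K, hK, hg⟩ := ContinuousLinearMap.exists_preimage_norm_le g hf
  set η := min (1 / 6) (ε / 8) with hη
  have hη0 : 0 < η := lt_min (by norm_num) (by positivity)
  refine ⟨η / K, by positivity, fun u hu => ?_⟩
  obtain ⟨a, ha, hna⟩ := hg (u - 1)
  have ha : f a = u - 1 := ha
  have hna : ‖(1 + a) - 1‖ ≤ η := by
    rw [add_sub_cancel_left]
    refine hna.trans ?_
    rw [lt_div_iff₀ hK] at hu
    linarith
  have hunit : IsUnit (1 + a) :=
    isUnit_of_norm_sub_one_lt (hna.trans_lt ((min_le_left _ _).trans_lt (by norm_num)))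
  refine ⟨⟨polarPart (1 + a), polarPart_mem_unitary hunit⟩, ?_, ?_⟩
  · change f (polarPart (1 + a)) = u
    rw [map_polarPart f hunit, map_add, map_one, ha, add_sub_cancel]
    have h0 : star (u : D) * u - 1 = 0 := by rw [Unitary.coe_star_mul_self, sub_self]
    have := norm_polarPart_sub_le (a := (u : D)) (by rw [h0, norm_zero]; norm_num)
    rw [h0, norm_zero, mul_zero] at this
    exact sub_eq_zero.1 (norm_le_zero_iff.1 this)
  · refine (norm_polarPart_sub_one_le hna (min_le_left _ _)).trans_lt ?_
    have := min_le_right (1 / 6) (ε / 8)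
    linarith

end CStarAlgebra

namespace ApproxInner

open CStarAlgebra CStarQuotient

variable {C D : Type*} [CStarAlgebra C] [CStarAlgebra D]

theorem continuous_unitaryMap (f : C →⋆ₐ[ℂ] D) : Continuous (unitaryMap f) :=
  ((map_continuous f).comp continuous_subtype_val).subtype_mk _

/-- The image of the unitary group under a surjective ⋆-homomorphism is open, and so is the image
of every open subgroup. -/
theorem isOpen_map_unitaryMap (f : C →⋆ₐ[ℂ] D) (hf : Function.Surjective f)
    {H : Subgroup (unitary C)} (hH : IsOpen (H : Set (unitary C))) :
    IsOpen ((H.map (unitaryMap f) : Subgroup (unitary D)) : Set (unitary D)) := by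
  obtain ⟨ε, hε, hb⟩ := Metric.isOpen_iff.1 hH 1 H.one_mem
  obtain ⟨δ, hδ, h⟩ := exists_unitary_lift_near_one f hf hε
  refine Subgroup.isOpen_of_mem_nhds (g := 1) _ (Filter.mem_of_superset (Metric.ball_mem_nhds 1 hδ) ?_)
  intro u hu
  obtain ⟨v, hv, hv1⟩ := h u (by rwa [Metric.mem_ball, Subtype.dist_eq, dist_eq_norm] at hu)
  exact ⟨v, hb (by rwa [Metric.mem_ball, Subtype.dist_eq, dist_eq_norm]), Subtype.ext hv⟩

theorem isClopen_of_isOpen {G : Type*} [Group G] [TopologicalSpace G] [IsTopologicalGroup G]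
    {H : Subgroup G} (hH : IsOpen (H : Set G)) : IsClopen (H : Set G) :=
  ⟨H.isClosed_of_isOpen hH, hH⟩

theorem unitaryMap_surjective_of_connected (f : C →⋆ₐ[ℂ] D) (hf : Function.Surjective f)
    (hD : ConnectedSpace (unitary D)) : Function.Surjective (unitaryMap f) := by
  have h := isOpen_map_unitaryMap f hf (H := ⊤) isOpen_univ
  have h1 := (isClopen_of_isOpen h).eq_univ ⟨1, one_mem _⟩
  intro u
  obtain ⟨v, -, hv⟩ : u ∈ ((Subgroup.map (unitaryMap f) ⊤ : Subgroup _) : Set (unitary D)) :=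
    h1 ▸ Set.mem_univ u
  exact ⟨v, hv⟩

/-- If `C` has stable rank one, unitaries lift from quotients of `C`: lift to any element, perturb
it to an invertible one, and take the polar part, which is a lift up to a unitary near `1`. -/
theorem unitaryMap_surjective_of_stableRankOne (f : C →⋆ₐ[ℂ] D) (hf : Function.Surjective f)
    (hC : HasStableRankOne C) : Function.Surjective (unitaryMap f) := by
  intro u
  obtain ⟨b, hb⟩ := hf u
  obtain ⟨δ, hδ, hlift⟩ := exists_unitary_lift_near_one f hf one_pos
  set η := min (1 / 6) (δ / 8) with hη
  have hη0 : 0 < η := lt_min (by norm_num) (by positivity)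
  have hopen : IsOpen {c : C | ‖star (u : D) * f c - 1‖ < η} := by
    have : Continuous f := map_continuous f
    exact isOpen_lt (by fun_prop) continuous_const
  obtain ⟨c, hcu, hc⟩ := hC.exists_mem_open hopen
    ⟨b, by simpa [hb] using hη0⟩
  have h1 : ‖star (u : D) * f c - 1‖ ≤ η := le_of_lt hc
  have h2 := norm_polarPart_sub_one_le h1 (min_le_left _ _)
  let w : unitary C := ⟨polarPart c, polarPart_mem_unitary hcu⟩
  have hw : f w = polarPart (f c) := map_polarPart f hcu
  have h3 : ((star u * unitaryMap f w : unitary D) : D) = polarPart (star (u : D) * f c) := by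
    have := polarPart_unitary_mul (star u) (f c)
    rw [Unitary.coe_star] at this
    rw [this, ← hw]
    rfl
  obtain ⟨z, hz, -⟩ := hlift (star u * unitaryMap f w) (by
    rw [h3]
    have := min_le_right (1 / 6) (δ / 8)
    linarith)
  have hz' : unitaryMap f z = star u * unitaryMap f w := Subtype.ext hz
  refine ⟨w * z⁻¹, ?_⟩
  rw [map_mul, map_inv, hz']
  change _ * (u⁻¹ * _)⁻¹ = u
  group

theorem isOpen_unitaryComponent : IsOpen (unitaryComponent C : Set (unitary C)) :=
  isOpen_connectedComponent

variable {A : Type*} [CStarAlgebra A] (I : Ideal A) [I.IsTwoSided] [hI : IsClosed (I : Set A)]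

theorem mkStar_surjective : Function.Surjective (mkStar I) := Ideal.Quotient.mk_surjective

/-- `U_A → U_{A/I}` is onto, as its image is an open subgroup. -/
theorem exists_lift_unitaryComponent {u : unitary (A ⧸ I)} (hu : u ∈ unitaryComponent (A ⧸ I)) :
    ∃ v ∈ unitaryComponent A, unitaryMap (mkStar I) v = u := by
  have h := isOpen_map_unitaryMap (mkStar I) (mkStar_surjective I) (isOpen_unitaryComponent (C := A))
  exact (isClopen_of_isOpen h).connectedComponent_subset (one_mem _) hu

theorem unitaryMap_mem_unitaryComponent (f : C →⋆ₐ[ℂ] D) {u : unitary C}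
    (hu : u ∈ unitaryComponent C) : unitaryMap f u ∈ unitaryComponent D := by
  have h1 := (continuous_unitaryMap f).image_connectedComponent_subset 1 ⟨u, hu, rfl⟩
  rwa [map_one] at h1

variable {I} in
/-- Two unitaries with the same image in `A/I` differ by an element of `U(Ĩ)`, which is `U_I` if
`U(Ĩ)` is connected. -/
theorem mul_inv_mem_idealUnitaryComponent (hU : ConnectedSpace (unitary (unitization I)))
    {u v : unitary A} (huv : unitaryMap (mkStar I) u = unitaryMap (mkStar I) v) :
    u * v⁻¹ ∈ idealUnitaryComponent I := by
  have h1 : unitaryMap (mkStar I) (u * v⁻¹) = 1 := by rw [map_mul, map_inv, huv, mul_inv_cancel]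
  have h2 : ((u * v⁻¹ : unitary A) : A) - 1 ∈ I := by
    rw [← Ideal.Quotient.eq, map_one]
    exact congrArg Subtype.val h1
  have h3 : ((u * v⁻¹ : unitary A) : A) ∈ unitization I := ⟨1, by rwa [map_one]⟩
  generalize u * v⁻¹ = w at h3
  let w' : unitary (unitization I) := ⟨⟨w, h3⟩, by
    constructor <;> apply Subtype.ext
    · exact Unitary.coe_star_mul_self w
    · exact Unitary.coe_mul_star_self w⟩
  refine ⟨w', ?_, rfl⟩
  change w' ∈ connectedComponent (1 : unitary (unitization I))
  rw [PreconnectedSpace.connectedComponent_eq_univ]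
  trivial

theorem idealUnitaryComponent_le : idealUnitaryComponent I ≤ unitaryComponent A := by
  rintro _ ⟨u, hu, rfl⟩
  have hc : Continuous (unitaryMap (unitization I).subtype) :=
    (continuous_subtype_val.comp continuous_subtype_val).subtype_mk _
  have := hc.image_connectedComponent_subset 1 ⟨u, hu, rfl⟩
  rwa [map_one] at this

end ApproxInner

/-! ### Quasi-central cutoffs -/

namespace CStarQuotient

variable {A : Type*} [CStarAlgebra A] (I : Ideal A) [I.IsTwoSided]

/-- A contraction `r ∈ 1 - I` that is small on finitely many elements of `I`, as a product of
cutoffs for the single elements. -/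
theorem exists_cutoff_finset (Y : Finset A) (hY : ∀ y ∈ Y, y ∈ I) {ε : ℝ} (hε : 0 < ε) :
    ∃ r : A, ‖r‖ ≤ 1 ∧ 1 - r ∈ I ∧ ∀ y ∈ Y, ‖y * r‖ ≤ ε := by
  classical
  induction Y using Finset.induction_on with
  | empty =>
    obtain ⟨r, -, h1, h2, -⟩ := exists_cutoff I (y := 0) (by simp) hε
    exact ⟨r, h1, h2, by simp⟩
  | insert y Y _ ih =>
    obtain ⟨r, h1, h2, h3⟩ := ih fun z hz => hY z (Finset.mem_insert_of_mem hz)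
    have hyr : y * r ∈ I := I.mul_mem_right _ (hY y (Finset.mem_insert_self _ _))
    obtain ⟨s, -, g1, g2, g3⟩ := exists_cutoff I (I.mul_mem_left (star (y * r)) hyr) hε
    refine ⟨r * s, ?_, ?_, fun z hz => ?_⟩
    · exact (norm_mul_le _ _).trans (mul_le_one₀ h1 (norm_nonneg _) g1)
    · have : 1 - r * s = (1 - r) + r * (1 - s) := by noncomm_ring
      rw [this]
      exact I.add_mem h2 (I.mul_mem_left _ g2)
    · rw [← mul_assoc]
      rcases Finset.mem_insert.1 hz with rfl | hz
      · exact g3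
      · exact (norm_mul_le _ _).trans
          ((mul_le_of_le_one_right (norm_nonneg _) g1).trans (h3 z hz))

variable [hI : IsClosed (I : Set A)]

/-- Sums of `n` cutoffs whose commutators with the elements of a finite set have norm `O(√n)`:
each new cutoff is chosen so that its commutators are almost orthogonal to those of the
sum of the previous ones, which lie in `I`. -/
theorem exists_sum_cutoff (F Y : Finset A) (hY : ∀ y ∈ Y, y ∈ I) {ε : ℝ} (hε : 0 < ε) (n : ℕ) :
    ∃ s : A, ‖s‖ ≤ n ∧ (n : A) - s ∈ I ∧ (∀ y ∈ Y, ‖y * s‖ ≤ n * ε) ∧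
      ∀ x ∈ F, ‖x * s - s * x‖ ^ 2 ≤ n * (1 + ‖x‖ + 4 * ‖x‖ ^ 2) := by
  classical
  induction n with
  | zero => exact ⟨0, by simp⟩
  | succ n ih =>
    obtain ⟨s, h1, h2, h3, h4⟩ := ih
    let T : A → A := fun x => x * s - s * x
    have hT : ∀ x, star (T x) ∈ I := fun x => by
      refine star_mem I ?_
      have : T x = (n - s) * x - x * (n - s) := by
        have := (Nat.cast_commute n x).eq
        simp only [T, sub_mul, mul_sub, this]
        abel
      rw [this]
      exact I.sub_mem (I.mul_mem_right _ h2) (I.mul_mem_left _ h2)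
    obtain ⟨r, g1, g2, g3⟩ := exists_cutoff_finset I
      (Y ∪ (F.image (fun x => star (T x)) ∪ F.image (fun x => star (T x) * x))) (by
        intro y hy
        simp only [Finset.mem_union, Finset.mem_image] at hy
        rcases hy with hy | ⟨x, -, rfl⟩ | ⟨x, -, rfl⟩
        · exact hY y hy
        · exact hT x
        · exact I.mul_mem_right _ (hT x)) (lt_min hε one_half_pos)
    refine ⟨s + r, ?_, ?_, fun y hy => ?_, fun x hx => ?_⟩
    · push_cast
      exact (norm_add_le _ _).trans (by gcongr)
    · push_cast
      rw [add_sub_add_comm]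
      exact I.add_mem h2 g2
    · push_cast
      rw [mul_add, add_mul, one_mul]
      exact (norm_add_le _ _).trans (add_le_add (h3 y hy)
        ((g3 y (Finset.mem_union_left _ hy)).trans (min_le_left _ _)))
    · set d := x * r - r * x with hd
      have e1 : x * (s + r) - (s + r) * x = T x + d := by
        simp only [T, hd, mul_add, add_mul]; abel
      have k1 : ‖star (T x) * r‖ ≤ 1 / 2 := (g3 _ (Finset.mem_union_right _
        (Finset.mem_union_left _ (Finset.mem_image_of_mem _ hx)))).trans (min_le_right _ _)
      have k2 : ‖star (T x) * x * r‖ ≤ 1 / 2 := (g3 _ (Finset.mem_union_right _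
        (Finset.mem_union_right _ (Finset.mem_image_of_mem (fun x => star (T x) * x) hx)))).trans
          (min_le_right _ _)
      have k3 : ‖star (T x) * d‖ ≤ (1 + ‖x‖) / 2 := by
        have : star (T x) * d = star (T x) * x * r - star (T x) * r * x := by
          rw [hd]; noncomm_ring
        rw [this]
        refine (norm_sub_le _ _).trans ?_
        have : ‖star (T x) * r * x‖ ≤ 1 / 2 * ‖x‖ := (norm_mul_le _ _).trans (by gcongr)
        linarith
      have k4 : ‖d‖ ≤ 2 * ‖x‖ := by
        have a1 : ‖x * r‖ ≤ ‖x‖ :=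
          (norm_mul_le _ _).trans (mul_le_of_le_one_right (norm_nonneg _) g1)
        have a2 : ‖r * x‖ ≤ ‖x‖ :=
          (norm_mul_le _ _).trans (mul_le_of_le_one_left (norm_nonneg _) g1)
        exact (norm_sub_le _ _).trans (by linarith)
      have k5 : ‖star d * T x‖ = ‖star (T x) * d‖ := by
        rw [← norm_star, star_mul, star_star]
      have k6 : ‖d‖ ^ 2 ≤ 4 * ‖x‖ ^ 2 := by
        nlinarith [norm_nonneg d, norm_nonneg x]
      rw [e1, sq, ← CStarRing.norm_star_mul_self]
      have e2 : star (T x + d) * (T x + d) =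
          (star (T x) * T x + star (T x) * d) + (star d * T x + star d * d) := by
        rw [star_add]; noncomm_ring
      have e3 : ‖star (T x + d) * (T x + d)‖ ≤
          (‖T x‖ ^ 2 + ‖star (T x) * d‖) + (‖star (T x) * d‖ + ‖d‖ ^ 2) := by
        rw [e2]
        refine (norm_add_le _ _).trans (add_le_add ((norm_add_le _ _).trans ?_)
          ((norm_add_le _ _).trans ?_))
        · rw [CStarRing.norm_star_mul_self, sq]
        · rw [k5, CStarRing.norm_star_mul_self, sq]
      have := h4 x hx
      push_cast
      change ‖T x‖ ^ 2 ≤ _ at this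
      linarith

/-- Elements `r ∈ 1 - I` coming from a quasi-central approximate unit of `I`: contractions that
almost commute with finitely many elements of `A` and are small on finitely many elements of `I`. -/
theorem exists_quasicentral_cutoff (F Y : Finset A) (hY : ∀ y ∈ Y, y ∈ I) {ε : ℝ} (hε : 0 < ε) :
    ∃ r : A, ‖r‖ ≤ 1 ∧ 1 - r ∈ I ∧ (∀ x ∈ F, ‖x * r - r * x‖ ≤ ε) ∧ ∀ y ∈ Y, ‖y * r‖ ≤ ε := by
  set K : A → ℝ := fun x => 1 + ‖x‖ + 4 * ‖x‖ ^ 2 with hK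
  have hK0 : ∀ x, 0 ≤ K x := fun x => by positivity
  obtain ⟨n, hn⟩ := exists_nat_gt ((∑ x ∈ F, K x) / ε ^ 2)
  have hn0 : (0 : ℝ) < n := lt_of_le_of_lt (by positivity) hn
  rw [div_lt_iff₀ (by positivity)] at hn
  obtain ⟨s, h1, h2, h3, h4⟩ := exists_sum_cutoff I F Y hY hε n
  have hnorm : ∀ z : A, ‖((n : ℂ)⁻¹) • z‖ = ‖z‖ / n := fun z => by
    rw [norm_smul, norm_inv, Complex.norm_natCast, inv_mul_eq_div]
  have hnC : (n : ℂ) ≠ 0 := by exact_mod_cast hn0.ne'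
  refine ⟨((n : ℂ)⁻¹) • s, ?_, ?_, fun x hx => ?_, fun y hy => ?_⟩
  · rw [hnorm, div_le_one hn0]
    exact h1
  · have : 1 - ((n : ℂ)⁻¹) • s = ((n : ℂ)⁻¹) • ((n : A) - s) := by
      rw [smul_sub]
      congr 1
      rw [eq_inv_smul_iff₀ hnC, Nat.cast_smul_eq_nsmul, nsmul_one]
    rw [this]
    exact Submodule.smul_of_tower_mem I _ h2
  · rw [mul_smul_comm, smul_mul_assoc, ← smul_sub, hnorm, div_le_iff₀ hn0]
    have h5 := h4 x hx
    have h6 : K x ≤ ∑ x ∈ F, K x := Finset.single_le_sum (fun x _ => hK0 x) hx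
    have h7 : (n : ℝ) * K x ≤ n * (n * ε ^ 2) := by gcongr; linarith
    exact abs_le_of_sq_le_sq' (by nlinarith) (by positivity) |>.2
  · rw [mul_smul_comm, hnorm, div_le_iff₀ hn0, mul_comm ε]
    exact h3 y hy

/-- Within its class modulo `I`, an element can be cut down so that its commutators with finitely
many elements are almost as small as they are modulo `I`. -/
theorem exists_cutoff_commutator (a : A) (F : Finset A) {ε : ℝ} (hε : 0 < ε) :
    ∃ r : A, ‖r‖ ≤ 1 ∧ 1 - r ∈ I ∧ ∀ x ∈ F, ‖x * (a * r) - a * r * x‖ ≤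
      ‖Ideal.Quotient.mk I (x * a - a * x)‖ + ε := by
  classical
  have h : ∀ x, ∃ b, Ideal.Quotient.mk I b = Ideal.Quotient.mk I (x * a - a * x) ∧
      ‖b‖ < ‖Ideal.Quotient.mk I (x * a - a * x)‖ + ε / 3 :=
    fun x => exists_norm_lt I _ (by positivity)
  choose b hb1 hb2 using h
  set δ := min (ε / 3) (ε / (3 * (‖a‖ + 1))) with hδ
  have hδ0 : 0 < δ := lt_min (by positivity) (by positivity)
  obtain ⟨r, h1, h2, h3, h4⟩ := exists_quasicentral_cutoff I F
    (F.image fun x => (x * a - a * x) - b x) (by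
      intro y hy
      obtain ⟨x, -, rfl⟩ := Finset.mem_image.1 hy
      exact Ideal.Quotient.eq.1 (hb1 x).symm) hδ0
  refine ⟨r, h1, h2, fun x hx => ?_⟩
  have e : x * (a * r) - a * r * x =
      b x * r + ((x * a - a * x) - b x) * r + a * (x * r - r * x) := by noncomm_ring
  have k1 : ‖b x * r‖ ≤ ‖b x‖ :=
    (norm_mul_le _ _).trans (mul_le_of_le_one_right (norm_nonneg _) h1)
  have k2 := (h4 _ (Finset.mem_image_of_mem (fun x => (x * a - a * x) - b x) hx)).trans
    (min_le_left _ _)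
  have k3 : ‖a * (x * r - r * x)‖ ≤ ε / 3 := by
    have h5 := (h3 x hx).trans (min_le_right _ _)
    calc _ ≤ ‖a‖ * ‖x * r - r * x‖ := norm_mul_le _ _
      _ ≤ (‖a‖ + 1) * (ε / (3 * (‖a‖ + 1))) := by gcongr; linarith
      _ = ε / 3 := by field_simp
  have k4 := hb2 x
  rw [e]
  exact norm_add₃_le.trans (by linarith)

end CStarQuotient

/-! ### Lifting central sequences -/

namespace ApproxInner

open CStarAlgebra CStarQuotient

section Functoriality

variable {A B : Type*} [CStarAlgebra A] [CStarAlgebra B]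

/-- The ⋆-homomorphism `ℓ^∞(A) → ℓ^∞(B)` applying `f : A → B` to every term. -/
def seqMap (f : A →⋆ₐ[ℂ] B) : (ℕ →ᵇ A) →⋆ₐ[ℂ] (ℕ →ᵇ B) where
  toFun x := BoundedContinuousFunction.ofNormedAddCommGroupDiscrete (fun n => f (x n)) ‖x‖
    fun n => (NonUnitalStarAlgHom.norm_apply_le f (x n)).trans (x.norm_coe_le_norm n)
  map_one' := by ext; exact map_one f
  map_mul' x y := by ext n; exact map_mul f (x n) (y n)
  map_zero' := by ext; exact map_zero f
  map_add' x y := by ext n; exact map_add f (x n) (y n)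
  commutes' c := by ext; exact AlgHomClass.commutes f c
  map_star' x := by ext n; exact map_star f (x n)

variable (ω : Ultrafilter ℕ)

theorem seqMap_mem_cIdeal (f : A →⋆ₐ[ℂ] B) {x : ℕ →ᵇ A} (hx : x ∈ cIdeal ω A) :
    seqMap f x ∈ cIdeal ω B :=
  squeeze_zero (fun _ => norm_nonneg _)
    (fun n => NonUnitalStarAlgHom.norm_apply_le f (x n)) ((mem_cIdeal ω A).1 hx)

/-- The ⋆-homomorphism `A_ω → B_ω` induced by `f : A → B`. -/
def ultrapowerMap (f : A →⋆ₐ[ℂ] B) : Ultrapower ω A →⋆ₐ[ℂ] Ultrapower ω B :=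
  { Ideal.Quotient.liftₐ (cIdeal ω A) ((mkStar (cIdeal ω B)).comp (seqMap f)).toAlgHom
      (fun _ hx => Ideal.Quotient.eq_zero_iff_mem.2 (seqMap_mem_cIdeal ω f hx)) with
    map_star' := by
      intro x
      obtain ⟨a, rfl⟩ := Ideal.Quotient.mk_surjective x
      exact congrArg (Ideal.Quotient.mk _) (map_star (seqMap f) a) }

theorem ultrapowerMap_diagonal (f : A →⋆ₐ[ℂ] B) (a : A) :
    ultrapowerMap ω f (diagonal ω A a) = diagonal ω B (f a) := rfl

theorem mk_eq_mk_iff {x y : ℕ →ᵇ A} :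
    Ideal.Quotient.mk (cIdeal ω A) x = Ideal.Quotient.mk _ y ↔
      Tendsto (fun n => ‖x n - y n‖) ω (𝓝 0) := Ideal.Quotient.eq

theorem diagonal_mul_mk_eq_iff {a : A} {x : ℕ →ᵇ A} :
    diagonal ω A a * Ideal.Quotient.mk _ x = Ideal.Quotient.mk _ x * diagonal ω A a ↔
      Tendsto (fun n => ‖a * x n - x n * a‖) ω (𝓝 0) := by
  rw [diagonal_apply, ← map_mul, ← map_mul, mk_eq_mk_iff]
  rfl

instance : IsClosed (centralSequenceAlgebra ω A : Set (Ultrapower ω A)) :=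
  Set.isClosed_centralizer _

/-- It suffices to check centrality in `A_ω` on a dense subset of `A`. -/
theorem mem_centralSequenceAlgebra_of_dense {ι : Type*} {d : ι → A} (hd : DenseRange d)
    {x : Ultrapower ω A} (h : ∀ i, diagonal ω A (d i) * x = x * diagonal ω A (d i)) :
    x ∈ centralSequenceAlgebra ω A := by
  rw [mem_centralSequenceAlgebra]
  intro a
  have hc : Continuous (diagonal ω A) := map_continuous _
  exact hd.induction_on a (isClosed_eq (by fun_prop) (by fun_prop)) h

end Functoriality

variable {A : Type*} [CStarAlgebra A] (ω : Ultrafilter ℕ)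
  (I : Ideal A) [I.IsTwoSided] [hI : IsClosed (I : Set A)]

/-- The ⋆-homomorphism `A' ∩ A_ω → (A/I)' ∩ (A/I)_ω` induced by the quotient map. -/
def centralMap : centralSequenceAlgebra ω A →⋆ₐ[ℂ] centralSequenceAlgebra ω (A ⧸ I) :=
  StarAlgHom.codRestrict ((ultrapowerMap ω (mkStar I)).comp (centralSequenceAlgebra ω A).subtype)
    _ (by
      rintro ⟨x, hx⟩
      rw [mem_centralSequenceAlgebra] at hx ⊢
      intro b
      obtain ⟨a, rfl⟩ := mkStar_surjective I b
      change _ * ultrapowerMap ω _ x = ultrapowerMap ω _ x * _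
      rw [← ultrapowerMap_diagonal, ← map_mul, ← map_mul, hx a])

theorem coe_centralMap (x : centralSequenceAlgebra ω A) :
    (centralMap ω I x : Ultrapower ω (A ⧸ I)) = ultrapowerMap ω (mkStar I) x := rfl

variable {ω} in
theorem tendsto_one_div_of_le_cofinite (hω : (ω : Filter ℕ) ≤ cofinite) :
    Tendsto (fun n : ℕ => 1 / ((n : ℝ) + 1)) ω (𝓝 0) :=
  tendsto_one_div_add_atTop_nhds_zero_nat.mono_left (Nat.cofinite_eq_atTop ▸ hω)

variable {ω} in
theorem eventually_ge_of_le_cofinite (hω : (ω : Filter ℕ) ≤ cofinite) (k : ℕ) :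
    ∀ᶠ n in (ω : Filter ℕ), k ≤ n :=
  (Nat.cofinite_eq_atTop ▸ hω : (ω : Filter ℕ) ≤ atTop) (eventually_ge_atTop k)

/-- Central sequences of `A/I` lift to central sequences of `A`: lift termwise and multiply
the `n`-th term by a cutoff that makes it almost commute with the first `n` terms of a
dense sequence. -/
theorem centralMap_surjective [TopologicalSpace.SeparableSpace A]
    (hω : (ω : Filter ℕ) ≤ cofinite) : Function.Surjective (centralMap ω I) := by
  classical
  rintro ⟨y, hy⟩
  obtain ⟨b, rfl⟩ := Ideal.Quotient.mk_surjective y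
  choose a ha hna using fun n => exists_norm_lt I (b n) one_pos
  set d := TopologicalSpace.denseSeq A with hd
  choose r hr1 hr2 hr3 using fun n : ℕ => exists_cutoff_commutator I (a n)
    ((Finset.range (n + 1)).image d) (ε := 1 / ((n : ℝ) + 1)) (by positivity)
  let c : ℕ →ᵇ A := BoundedContinuousFunction.ofNormedAddCommGroupDiscrete
    (fun n => a n * r n) (‖b‖ + 1) fun n => by
      refine (norm_mul_le _ _).trans ((mul_le_of_le_one_right (norm_nonneg _) (hr1 n)).trans ?_)
      have := b.norm_coe_le_norm n
      linarith [hna n]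
  have hc : seqMap (mkStar I) c = b := by
    ext n
    rw [← ha n]
    refine (Ideal.Quotient.eq.2 ?_)
    have : a n * r n - a n = -(a n * (1 - r n)) := by noncomm_ring
    change a n * r n - a n ∈ I
    rw [this]
    exact I.neg_mem (I.mul_mem_left _ (hr2 n))
  have hcen : Ideal.Quotient.mk _ c ∈ centralSequenceAlgebra ω A := by
    refine mem_centralSequenceAlgebra_of_dense ω (TopologicalSpace.denseRange_denseSeq A) fun k => ?_
    rw [diagonal_mul_mk_eq_iff]
    have h1 := (diagonal_mul_mk_eq_iff ω).1
      ((mem_centralSequenceAlgebra ω _).1 hy (Ideal.Quotient.mk I (d k)))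
    have h2 := h1.add (tendsto_one_div_of_le_cofinite hω)
    rw [add_zero] at h2
    refine squeeze_zero' (Eventually.of_forall fun _ => norm_nonneg _) ?_ h2
    filter_upwards [eventually_ge_of_le_cofinite hω k] with n hn
    have := hr3 n (d k) (Finset.mem_image_of_mem d (Finset.mem_range.2 (Nat.lt_succ_of_le hn)))
    rwa [map_sub, map_mul, map_mul, ha n] at this
  refine ⟨⟨_, hcen⟩, Subtype.ext ?_⟩
  rw [coe_centralMap]
  change Ideal.Quotient.mk _ (seqMap (mkStar I) c) = _
  rw [hc]

/-- If `A' ∩ A_ω` has stable rank one or `U((A/I)' ∩ (A/I)_ω)` is connected, then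
unitaries of `(A/I)' ∩ (A/I)_ω` lift to unitaries of `A' ∩ A_ω`. -/
theorem unitaryMap_centralMap_surjective [TopologicalSpace.SeparableSpace A]
    (hω : (ω : Filter ℕ) ≤ cofinite)
    (h : HasStableRankOne (centralSequenceAlgebra ω A) ∨
      ConnectedSpace (unitary (centralSequenceAlgebra ω (A ⧸ I)))) :
    Function.Surjective (unitaryMap (centralMap ω I)) := by
  have hs := centralMap_surjective ω I hω
  rcases h with h | h
  · exact unitaryMap_surjective_of_stableRankOne _ hs h
  · exact unitaryMap_surjective_of_connected _ hs h

theorem norm_unitary_le_one {C : Type*} [CStarAlgebra C] (u : unitary C) : ‖(u : C)‖ ≤ 1 := by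
  rcases subsingleton_or_nontrivial C with hC | hC
  · rw [Subsingleton.elim (u : C) 0, norm_zero]
    exact zero_le_one
  · rw [CStarRing.norm_coe_unitary]

/-- An almost unitary element of `A` that is almost a lift of a unitary `u` of `A/I` is close to a
unitary lift of `u`. -/
theorem exists_unitary_lift_near {ε : ℝ} (hε : 0 < ε) :
    ∃ η > 0, ∀ (a : A) (u : unitary (A ⧸ I)), ‖star a * a - 1‖ < η → ‖a * star a - 1‖ < η →
      ‖mkStar I a - u‖ < η → ∃ v : unitary A, unitaryMap (mkStar I) v = u ∧ ‖(v : A) - a‖ < ε := by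
  obtain ⟨δ, hδ, hlift⟩ := exists_unitary_lift_near_one (mkStar I) (mkStar_surjective I) (half_pos hε)
  refine ⟨min (1 / 2) (min (ε / 8) (δ / 8)), by positivity, fun a u h1 h2 h3 => ?_⟩
  set η := min (1 / 2 : ℝ) (min (ε / 8) (δ / 8)) with hη
  have e1 : η ≤ 1 / 2 := min_le_left _ _
  have e2 : η ≤ ε / 8 := (min_le_right _ _).trans (min_le_left _ _)
  have e3 : η ≤ δ / 8 := (min_le_right _ _).trans (min_le_right _ _)
  have hunit : IsUnit a := by
    have k1 := isUnit_of_norm_sub_one_lt (h1.trans_le (e1.trans (by norm_num)))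
    have k2 := isUnit_of_norm_sub_one_lt (h2.trans_le (e1.trans (by norm_num)))
    obtain ⟨x, hx⟩ := k1.exists_left_inv
    obtain ⟨y, hy⟩ := k2.exists_right_inv
    rw [← mul_assoc] at hx
    rw [mul_assoc] at hy
    exact isUnit_iff_exists_and_exists.2 ⟨⟨_, hy⟩, ⟨_, hx⟩⟩
  have hna : ‖a‖ ≤ 2 := by
    have k1 : ‖star a * a‖ ≤ 3 / 2 := by
      have := norm_add_le (star a * a - 1) 1
      rw [sub_add_cancel] at this
      have := norm_unitary_le_one (1 : unitary A)
      rw [OneMemClass.coe_one] at this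
      linarith
    rw [CStarRing.norm_star_mul_self] at k1
    nlinarith [norm_nonneg a]
  let w : unitary A := ⟨polarPart a, polarPart_mem_unitary hunit⟩
  have hw : ‖(w : A) - a‖ ≤ 2 * η :=
    (norm_polarPart_sub_le (h1.le.trans e1)).trans
      (mul_le_mul hna h1.le (norm_nonneg _) (by norm_num))
  have hwu : ‖(u : A ⧸ I) - mkStar I w‖ ≤ 3 * η := by
    have k1 : ‖mkStar I ((w : A) - a)‖ ≤ 2 * η := (norm_mk_le I _).trans hw
    have k2 := norm_add_le (mkStar I ((w : A) - a)) (mkStar I a - u)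
    rw [map_sub, sub_add_sub_cancel, ← map_sub, norm_sub_rev] at k2
    linarith
  obtain ⟨z, hz, hz1⟩ := hlift ((unitaryMap (mkStar I) w)⁻¹ * u) (by
    have : (((unitaryMap (mkStar I) w)⁻¹ * u : unitary (A ⧸ I)) : A ⧸ I) - 1 =
        ((unitaryMap (mkStar I) w)⁻¹ : unitary (A ⧸ I)) * ((u : A ⧸ I) - mkStar I w) := by
      have k : (((unitaryMap (mkStar I) w)⁻¹ : unitary (A ⧸ I)) : A ⧸ I) * mkStar I w = 1 :=
        congrArg Subtype.val (inv_mul_cancel (unitaryMap (mkStar I) w))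
      rw [mul_sub, k]
      rfl
    rw [this]
    refine (norm_mul_le _ _).trans_lt ?_
    have := mul_le_of_le_one_left (norm_nonneg ((u : A ⧸ I) - mkStar I w))
      (norm_unitary_le_one (unitaryMap (mkStar I) w)⁻¹)
    linarith)
  refine ⟨w * z, ?_, ?_⟩
  · have hz' : unitaryMap (mkStar I) z = (unitaryMap (mkStar I) w)⁻¹ * u := Subtype.ext hz
    rw [map_mul, hz', mul_inv_cancel_left]
  · have k1 : ((w * z : unitary A) : A) - a = w * ((z : A) - 1) + ((w : A) - a) := by
      rw [mul_sub, mul_one]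
      simp
    rw [k1]
    have k2 : ‖(w : A) * ((z : A) - 1)‖ ≤ ‖(z : A) - 1‖ := (norm_mul_le _ _).trans
      (mul_le_of_le_one_left (norm_nonneg _) (norm_unitary_le_one w))
    exact (norm_add_le _ _).trans_lt (by linarith)

variable {ω} in
/-- The key lifting property: a unitary in `U_{A/I}` that almost commutes with the image of a
suitable finite subset of `A` has a lift in `U_A` that almost commutes with a given finite subset.
Otherwise, counterexamples for finer and finer data would form a unitary of `(A/I)' ∩ (A/I)_ω`, and
a unitary lift of it in `A' ∩ A_ω` would refute almost all of them. -/
theorem exists_lift_almost_commuting [TopologicalSpace.SeparableSpace A]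
    (hω : (ω : Filter ℕ) ≤ cofinite) (hU : ConnectedSpace (unitary (unitization I)))
    (hlift : Function.Surjective (unitaryMap (centralMap ω I))) (F : Finset A) {ε : ℝ}
    (hε : 0 < ε) :
    ∃ (G : Finset A) (δ : ℝ), 0 < δ ∧ ∀ u ∈ unitaryComponent (A ⧸ I),
      (∀ g ∈ G, ‖mkStar I g * u - u * mkStar I g‖ < δ) →
      ∃ v ∈ unitaryComponent A, unitaryMap (mkStar I) v = u ∧ ∀ x ∈ F, ‖x * v - v * x‖ < ε := by
  classical
  by_contra! hcon
  set d := TopologicalSpace.denseSeq A with hd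
  choose u hu hcomm hbad using fun n : ℕ => hcon ((Finset.range (n + 1)).image d)
    (1 / ((n : ℝ) + 1)) (by positivity)
  let s : ℕ →ᵇ (A ⧸ I) := BoundedContinuousFunction.ofNormedAddCommGroupDiscrete
    (fun n => (u n : A ⧸ I)) 1 fun n => norm_unitary_le_one (u n)
  have hs : Ideal.Quotient.mk _ s ∈ centralSequenceAlgebra ω (A ⧸ I) := by
    have hdense : DenseRange fun k => mkStar I (d k) :=
      (mkStar_surjective I).denseRange.comp (TopologicalSpace.denseRange_denseSeq A)
        (continuous_mkStar I)
    refine mem_centralSequenceAlgebra_of_dense ω hdense fun k => ?_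
    rw [diagonal_mul_mk_eq_iff]
    refine squeeze_zero' (Eventually.of_forall fun _ => norm_nonneg _) ?_
      (tendsto_one_div_of_le_cofinite hω)
    filter_upwards [eventually_ge_of_le_cofinite hω k] with n hn
    exact (hcomm n (d k)
      (Finset.mem_image_of_mem d (Finset.mem_range.2 (Nat.lt_succ_of_le hn)))).le
  have hs1 : star s * s = 1 := by ext n; exact Unitary.coe_star_mul_self (u n)
  have hs2 : s * star s = 1 := by ext n; exact Unitary.coe_mul_star_self (u n)
  let U : unitary (centralSequenceAlgebra ω (A ⧸ I)) := ⟨⟨_, hs⟩, by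
    constructor <;> apply Subtype.ext
    · change star (Ideal.Quotient.mk _ s) * Ideal.Quotient.mk _ s = 1
      rw [star_mk, ← map_mul, hs1, map_one]
    · change Ideal.Quotient.mk _ s * star (Ideal.Quotient.mk _ s) = 1
      rw [star_mk, ← map_mul, hs2, map_one]⟩
  obtain ⟨⟨⟨V, hVc⟩, hVu⟩, hVU⟩ := hlift U
  obtain ⟨a, rfl⟩ := Ideal.Quotient.mk_surjective V
  have h1 : Tendsto (fun n => ‖star (a n) * a n - 1‖) ω (𝓝 0) := by
    have : star (Ideal.Quotient.mk (cIdeal ω A) a) * Ideal.Quotient.mk _ a = 1 :=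
      congrArg Subtype.val hVu.1
    rw [star_mk, ← map_mul, ← map_one (Ideal.Quotient.mk (cIdeal ω A)), mk_eq_mk_iff] at this
    exact this
  have h2 : Tendsto (fun n => ‖a n * star (a n) - 1‖) ω (𝓝 0) := by
    have : Ideal.Quotient.mk (cIdeal ω A) a * star (Ideal.Quotient.mk _ a) = 1 :=
      congrArg Subtype.val hVu.2
    rw [star_mk, ← map_mul, ← map_one (Ideal.Quotient.mk (cIdeal ω A)), mk_eq_mk_iff] at this
    exact this
  have h3 : Tendsto (fun n => ‖mkStar I (a n) - u n‖) ω (𝓝 0) := by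
    have : Ideal.Quotient.mk (cIdeal ω (A ⧸ I)) (seqMap (mkStar I) a) = Ideal.Quotient.mk _ s :=
      congrArg Subtype.val (congrArg Subtype.val hVU)
    rw [mk_eq_mk_iff] at this
    exact this
  have h4 : ∀ x, Tendsto (fun n => ‖x * a n - a n * x‖) ω (𝓝 0) := fun x =>
    (diagonal_mul_mk_eq_iff ω).1 ((mem_centralSequenceAlgebra ω _).1 hVc x)
  set M := ∑ x ∈ F, ‖x‖ with hM
  have hM0 : 0 ≤ M := by positivity
  obtain ⟨η, hη, hnear⟩ := exists_unitary_lift_near I (ε := ε / (4 * (M + 1))) (by positivity)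
  have h4' : ∀ᶠ n in (ω : Filter ℕ), ∀ x ∈ F, ‖x * a n - a n * x‖ < ε / 2 :=
    (Filter.eventually_all_finset F).2 fun x _ => (h4 x).eventually (gt_mem_nhds (half_pos hε))
  obtain ⟨n, k1, k2, k3, k4⟩ := ((h1.eventually (gt_mem_nhds hη)).and
    ((h2.eventually (gt_mem_nhds hη)).and ((h3.eventually (gt_mem_nhds hη)).and h4'))).exists
  obtain ⟨v, hv, hva⟩ := hnear (a n) (u n) k1 k2 k3
  have hvU : v ∈ unitaryComponent A := by
    obtain ⟨v₀, hv₀, h0⟩ := exists_lift_unitaryComponent I (hu n)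
    have := mul_mem (idealUnitaryComponent_le I
      (mul_inv_mem_idealUnitaryComponent hU (hv.trans h0.symm))) hv₀
    rwa [inv_mul_cancel_right] at this
  obtain ⟨x, hx, hxv⟩ := hbad n v hvU hv
  have e1 : x * v - v * x = (x * a n - a n * x) + (x * ((v : A) - a n) - ((v : A) - a n) * x) := by
    noncomm_ring
  have e2 : ‖x‖ ≤ M := Finset.single_le_sum (f := fun x => ‖x‖) (fun x _ => norm_nonneg x) hx
  have e3 : ‖x * ((v : A) - a n) - ((v : A) - a n) * x‖ ≤ ε / 2 := by
    refine (norm_sub_le _ _).trans ?_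
    have g1 := norm_mul_le x ((v : A) - a n)
    have g2 := norm_mul_le ((v : A) - a n) x
    have g3 : ‖x‖ * ‖(v : A) - a n‖ ≤ (M + 1) * (ε / (4 * (M + 1))) := by
      gcongr
      linarith
    have g4 : (M + 1) * (ε / (4 * (M + 1))) = ε / 4 := by field_simp
    linarith
  have e4 := norm_add_le (x * a n - a n * x) (x * ((v : A) - a n) - ((v : A) - a n) * x)
  rw [← e1] at e4
  linarith [k4 x hx]

end ApproxInner

/-! ### Almost open homomorphisms of complete groups are onto -/

/-- A homomorphism with dense range that is open onto its image is surjective if its domain is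
complete in the two-sided sense of `hG`. Given `φ`, one constructs `θₙ` and `κₙ` with
`f(θₙ)⁻¹ φ f(κₙ) → 1`. As `θ` is corrected, the size of the correction that keeps both `θₙ` and
`θₙ⁻¹` Cauchy depends on `θₙ` itself; correcting `θ` and `κ` in turn allows the error to be
made small relative to the factor that is corrected next. -/
theorem MonoidHom.surjective_of_denseRange_of_almost_open {G H : Type*} [Group G]
    [TopologicalSpace G] [IsTopologicalGroup G] [Group H] [TopologicalSpace H]
    [IsTopologicalGroup H] [T2Space H] (f : G →* H) (hf : Continuous f) (hd : DenseRange f)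
    (hopen : ∀ S ∈ 𝓝 (1 : G), ∃ W ∈ 𝓝 (1 : H), ∀ g, f g ∈ W → ∃ g' ∈ S, f g' = f g)
    (hG : ∃ N : ℕ → Set G, (∀ n, N n ∈ 𝓝 1) ∧ ∀ x : ℕ → G,
      (∀ n, (x n)⁻¹ * x (n + 1) ∈ N n ∧ x (n + 1) * (x n)⁻¹ ∈ N n) →
        ∃ l, Tendsto x atTop (𝓝 l))
    (hH : ∃ W : ℕ → Set H, (∀ n, W n ∈ 𝓝 1) ∧ ∀ y : ℕ → H, (∀ n, y n ∈ W n) →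
      Tendsto y atTop (𝓝 1)) : Function.Surjective f := by
  obtain ⟨N, hN, hlim⟩ := hG
  obtain ⟨W, hW, hWlim⟩ := hH
  -- `M n θ` is how close to `1` the error has to be for an admissible `n`-th correction of `θ`.
  have hM : ∀ (n : ℕ) (θ : G), ∃ M : Set H, IsOpen M ∧ (1 : H) ∈ M ∧ M ⊆ W n ∧
      ∀ g, f g ∈ M → ∃ η, (η ∈ N n ∧ θ * η * θ⁻¹ ∈ N n) ∧ f η = f g := by
    intro n θ
    have hc : Tendsto (fun η => θ * η * θ⁻¹) (𝓝 1) (𝓝 1) := by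
      have : Continuous fun η => θ * η * θ⁻¹ := by fun_prop
      simpa using this.tendsto 1
    obtain ⟨Z, hZ, h⟩ := hopen _ (inter_mem (hN n) (hc (hN n)))
    obtain ⟨M, hMs, hMo, hM1⟩ := mem_nhds_iff.1 (inter_mem hZ (hW n))
    refine ⟨M, hMo, hM1, fun y hy => (hMs hy).2, fun g hg => ?_⟩
    exact h g (hMs hg).1
  choose M hMo hM1 hMW hMl using hM
  have hstep : ∀ (φ : H) (n : ℕ) (θ κ : G) (T : Set H), IsOpen T → (1 : H) ∈ T →
      (f θ)⁻¹ * φ * f κ ∈ M n θ → ∃ θ', ((θ⁻¹ * θ' ∈ N n) ∧ θ' * θ⁻¹ ∈ N n) ∧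
        (f θ')⁻¹ * φ * f κ ∈ T := by
    intro φ n θ κ T hT hT1 hr
    have hO : IsOpen (M n θ ∩ {y | y⁻¹ * ((f θ)⁻¹ * φ * f κ) ∈ T}) :=
      (hMo n θ).inter (hT.preimage (by fun_prop))
    obtain ⟨g, hg1, hg2⟩ := hd.exists_mem_open hO ⟨_, hr, by
      change _⁻¹ * _ ∈ T
      rwa [inv_mul_cancel]⟩
    obtain ⟨η, ⟨h1, h2⟩, h3⟩ := hMl n θ g hg1
    refine ⟨θ * η, ⟨by rwa [inv_mul_cancel_left], h2⟩, ?_⟩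
    rw [map_mul, h3, mul_inv_rev]
    have hg2 : (f g)⁻¹ * ((f θ)⁻¹ * φ * f κ) ∈ T := hg2
    simpa only [mul_assoc] using hg2
  intro φ
  let State : ℕ → G × G → Prop := fun n p => (f p.1)⁻¹ * φ * f p.2 ∈ M n p.1
  have hnext : ∀ (n : ℕ) (p : {p // State n p}), ∃ q : {q // State (n + 1) q},
      ((p.1.1⁻¹ * q.1.1 ∈ N n) ∧ q.1.1 * p.1.1⁻¹ ∈ N n) ∧
      ((p.1.2⁻¹ * q.1.2 ∈ N n) ∧ q.1.2 * p.1.2⁻¹ ∈ N n) := by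
    rintro n ⟨⟨θ, κ⟩, hp⟩
    obtain ⟨θ', h1, h2⟩ := hstep φ n θ κ (M n κ)⁻¹ (hMo n κ).inv (by simpa using hM1 n κ) hp
    obtain ⟨κ', h3, h4⟩ := hstep φ⁻¹ n κ θ' (M (n + 1) θ')⁻¹ (hMo _ _).inv
      (by simpa using hM1 _ _) (by simpa [mul_assoc] using h2)
    exact ⟨⟨(θ', κ'), by simpa [State, mul_assoc] using h4⟩, h1, h3⟩
  obtain ⟨κ₀, hκ₀⟩ : ∃ κ₀, State 0 (1, κ₀) := by
    obtain ⟨κ₀, h⟩ := hd.exists_mem_open (s := {y | φ * y ∈ M 0 1})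
      ((hMo 0 1).preimage (by fun_prop)) ⟨φ⁻¹, by simpa using hM1 0 1⟩
    exact ⟨κ₀, by simpa [State] using h⟩
  choose next hnx using hnext
  let p : ∀ n, {p // State n p} := fun n => Nat.rec ⟨(1, κ₀), hκ₀⟩ (fun n p => next n p) n
  obtain ⟨l, hl⟩ := hlim (fun n => (p n).1.1) fun n => (hnx n (p n)).1
  obtain ⟨m, hm⟩ := hlim (fun n => (p n).1.2) fun n => (hnx n (p n)).2
  have h1 : Tendsto (fun n => (f (p n).1.1)⁻¹ * φ * f (p n).1.2) atTop (𝓝 1) :=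
    hWlim _ fun n => hMW _ _ (p n).2
  have h2 : Tendsto (fun n => (f (p n).1.1)⁻¹ * φ * f (p n).1.2) atTop
      (𝓝 ((f l)⁻¹ * φ * f m)) :=
    ((((hf.tendsto l).comp hl).inv).mul_const φ).mul ((hf.tendsto m).comp hm)
  have h3 := tendsto_nhds_unique h2 h1
  refine ⟨l * m⁻¹, ?_⟩
  rw [map_mul, map_inv, mul_inv_eq_iff_eq_mul]
  rw [mul_assoc, inv_mul_eq_one] at h3
  exact h3

/-! ### The topology of the automorphism group -/

namespace StarAlgEquiv

variable {C : Type*} [CStarAlgebra C]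

theorem tendsto_iff_eval {ι : Type*} {l : Filter ι} {x : ι → (C ≃⋆ₐ[ℂ] C)} {φ : C ≃⋆ₐ[ℂ] C} :
    Tendsto x l (𝓝 φ) ↔ ∀ a, Tendsto (fun i => x i a) l (𝓝 (φ a)) := by
  have : IsInducing (fun φ : C ≃⋆ₐ[ℂ] C => (φ : C → C)) := ⟨rfl⟩
  rw [this.tendsto_nhds_iff, tendsto_pi_nhds]
  rfl

instance : T2Space (C ≃⋆ₐ[ℂ] C) :=
  T2Space.of_injective_continuous (f := fun φ : C ≃⋆ₐ[ℂ] C => (φ : C → C)) DFunLike.coe_injective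
    continuous_induced_dom

/-- The automorphisms that are `ε`-close to `φ` on a finite set. -/
theorem setOf_close_mem_nhds (φ : C ≃⋆ₐ[ℂ] C) (F : Finset C) {ε : ℝ} (hε : 0 < ε) :
    {ψ : C ≃⋆ₐ[ℂ] C | ∀ x ∈ F, ‖ψ x - φ x‖ < ε} ∈ 𝓝 φ := by
  refine (Filter.eventually_all_finset F).2 fun x _ => ?_
  have h : Continuous fun ψ : C ≃⋆ₐ[ℂ] C => ‖ψ x - φ x‖ :=
    ((continuous_eval x).sub continuous_const).norm
  exact h.tendsto φ (gt_mem_nhds (by simpa using hε))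

theorem exists_close_of_mem_nhds {φ : C ≃⋆ₐ[ℂ] C} {S : Set (C ≃⋆ₐ[ℂ] C)} (hS : S ∈ 𝓝 φ) :
    ∃ (F : Finset C) (ε : ℝ), 0 < ε ∧ ∀ ψ : C ≃⋆ₐ[ℂ] C, (∀ x ∈ F, ‖ψ x - φ x‖ < ε) → ψ ∈ S := by
  classical
  by_contra! h
  choose ψ hψ1 hψ2 using fun p : Finset C × ℕ => h p.1 (1 / ((p.2 : ℝ) + 1)) (by positivity)
  have ht : Tendsto ψ atTop (𝓝 φ) := by
    rw [tendsto_iff_eval]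
    intro a
    rw [Metric.tendsto_atTop]
    intro ε hε
    obtain ⟨n, hn⟩ := exists_nat_one_div_lt hε
    refine ⟨({a}, n), fun p hp => ?_⟩
    rw [dist_eq_norm]
    refine (hψ1 p a (hp.1 (Finset.mem_singleton_self a))).trans_le (le_trans ?_ hn.le)
    have : (n : ℝ) ≤ p.2 := by exact_mod_cast hp.2
    gcongr
  obtain ⟨p, hp⟩ := (ht.eventually hS).exists
  exact hψ2 p hp

theorem inv_apply_apply_self (φ : C ≃⋆ₐ[ℂ] C) (a : C) : φ⁻¹ (φ a) = a := by
  rw [← mul_apply, inv_mul_cancel]; rfl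

theorem apply_inv_apply_self (φ : C ≃⋆ₐ[ℂ] C) (a : C) : φ (φ⁻¹ a) = a := by
  rw [← mul_apply, mul_inv_cancel]; rfl

/-- If `φₙ` and `φₙ⁻¹` converge pointwise then the limit of `φₙ` is an automorphism. -/
theorem exists_tendsto_of_cauchySeq {x : ℕ → (C ≃⋆ₐ[ℂ] C)} (h1 : ∀ a, CauchySeq fun n => x n a)
    (h2 : ∀ a, CauchySeq fun n => (x n)⁻¹ a) : ∃ φ, Tendsto x atTop (𝓝 φ) := by
  choose L hL using fun a => cauchySeq_tendsto_of_complete (h1 a)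
  choose K hK using fun a => cauchySeq_tendsto_of_complete (h2 a)
  refine ⟨{ toFun := L, invFun := K, left_inv := ?_, right_inv := ?_, map_mul' := ?_,
            map_add' := ?_, map_star' := ?_, map_smul' := ?_ }, tendsto_iff_eval.2 hL⟩
  · intro a
    refine tendsto_nhds_unique (hK (L a)) ?_
    rw [tendsto_iff_norm_sub_tendsto_zero]
    have : ∀ n, ‖(x n)⁻¹ (L a) - a‖ = ‖x n a - L a‖ := fun n => by
      rw [← norm_apply_sub (x n), apply_inv_apply_self, norm_sub_rev]
    simp only [this]
    exact tendsto_iff_norm_sub_tendsto_zero.1 (hL a)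
  · intro a
    refine tendsto_nhds_unique (hL (K a)) ?_
    rw [tendsto_iff_norm_sub_tendsto_zero]
    have : ∀ n, ‖x n (K a) - a‖ = ‖(x n)⁻¹ a - K a‖ := fun n => by
      rw [← norm_apply_sub (x n) ((x n)⁻¹ a), apply_inv_apply_self, norm_sub_rev]
    simp only [this]
    exact tendsto_iff_norm_sub_tendsto_zero.1 (hK a)
  · intro a b
    refine tendsto_nhds_unique (hL (a * b)) ?_
    simpa only [map_mul] using (hL a).mul (hL b)
  · intro a b
    refine tendsto_nhds_unique (hL (a + b)) ?_
    simpa only [map_add] using (hL a).add (hL b)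
  · intro a
    refine tendsto_nhds_unique (hL (star a)) ?_
    simpa only [map_star] using (hL a).star
  · intro c a
    refine tendsto_nhds_unique (hL (c • a)) ?_
    simpa only [map_smul] using (hL a).const_smul c

theorem cauchySeq_of_dense {ι : Type*} {d : ι → C} (hd : DenseRange d) {x : ℕ → (C ≃⋆ₐ[ℂ] C)}
    (h : ∀ i, CauchySeq fun n => x n (d i)) (a : C) : CauchySeq fun n => x n a := by
  rw [Metric.cauchySeq_iff']
  intro ε hε
  obtain ⟨i, hi⟩ := hd.exists_dist_lt a (show 0 < ε / 3 by positivity)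
  obtain ⟨n, hn⟩ := Metric.cauchySeq_iff'.1 (h i) (ε / 3) (by positivity)
  refine ⟨n, fun m hm => ?_⟩
  have e : ∀ k, dist (x k a) (x k (d i)) = dist a (d i) := fun k => by
    rw [dist_eq_norm, norm_apply_sub, dist_eq_norm]
  have h1 := dist_triangle4_right (x m a) (x n a) (x m (d i)) (x n (d i))
  rw [e, e] at h1
  linarith [hn m hm]

theorem tendsto_one_of_dense {ι : Type*} {d : ι → C} (hd : DenseRange d) {x : ℕ → (C ≃⋆ₐ[ℂ] C)}
    (h : ∀ i, Tendsto (fun n => x n (d i)) atTop (𝓝 (d i))) : Tendsto x atTop (𝓝 1) := by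
  refine tendsto_iff_eval.2 fun a => ?_
  change Tendsto _ _ (𝓝 a)
  rw [Metric.tendsto_atTop]
  intro ε hε
  obtain ⟨i, hi⟩ := hd.exists_dist_lt a (show 0 < ε / 3 by positivity)
  obtain ⟨n, hn⟩ := Metric.tendsto_atTop.1 (h i) (ε / 3) (by positivity)
  refine ⟨n, fun m hm => ?_⟩
  have e : dist (x m a) (x m (d i)) = dist a (d i) := by
    rw [dist_eq_norm, norm_apply_sub, dist_eq_norm]
  have h1 := dist_triangle4_right (x m a) a (x m (d i)) (d i)
  rw [e] at h1
  linarith [hn m hm]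

/-- The `n`-th of a sequence of neighbourhoods of the identity in `Aut(C)`, given by a (dense)
sequence `d`. -/
def basicNhd (d : ℕ → C) (n : ℕ) : Set (C ≃⋆ₐ[ℂ] C) := {η | ∀ k ≤ n, ‖η (d k) - d k‖ < (1 / 2) ^ n}

theorem basicNhd_mem_nhds (d : ℕ → C) (n : ℕ) : basicNhd d n ∈ 𝓝 (1 : C ≃⋆ₐ[ℂ] C) := by
  classical
  refine Filter.mem_of_superset (setOf_close_mem_nhds 1 ((Finset.range (n + 1)).image d)
    (ε := (1 / 2) ^ n) (by positivity)) fun η hη k hk => ?_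
  exact hη (d k) (Finset.mem_image_of_mem d (Finset.mem_range.2 (Nat.lt_succ_of_le hk)))

theorem tendsto_one_of_mem_basicNhd {d : ℕ → C} (hd : DenseRange d) {x : ℕ → (C ≃⋆ₐ[ℂ] C)}
    (h : ∀ n, x n ∈ basicNhd d n) : Tendsto x atTop (𝓝 1) := by
  refine tendsto_one_of_dense hd fun k => ?_
  rw [tendsto_iff_norm_sub_tendsto_zero]
  refine squeeze_zero' (Eventually.of_forall fun _ => norm_nonneg _) ?_
    (tendsto_pow_atTop_nhds_zero_of_lt_one (r := (1 / 2 : ℝ)) (by norm_num) (by norm_num))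
  filter_upwards [eventually_ge_atTop k] with n hn
  exact (h n k hn).le

theorem cauchySeq_of_mem_basicNhd {d : ℕ → C} (hd : DenseRange d) {x : ℕ → (C ≃⋆ₐ[ℂ] C)}
    (h : ∀ n, (x n)⁻¹ * x (n + 1) ∈ basicNhd d n) (a : C) : CauchySeq fun n => x n a := by
  refine cauchySeq_of_dense hd (fun k => ?_) a
  rw [← cauchySeq_shift k]
  refine cauchySeq_of_le_geometric (1 / 2) 1 (by norm_num) fun n => ?_
  have h1 := h (n + k) k (Nat.le_add_left _ _)
  rw [← norm_apply_sub (x (n + k)), ← mul_apply, mul_inv_cancel_left] at h1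
  rw [dist_eq_norm, norm_sub_rev, one_mul, add_right_comm]
  refine h1.le.trans ?_
  exact pow_le_pow_of_le_one (by norm_num) (by norm_num) (Nat.le_add_right _ _)

theorem exists_tendsto_of_mem_basicNhd {d : ℕ → C} (hd : DenseRange d) {x : ℕ → (C ≃⋆ₐ[ℂ] C)}
    (h1 : ∀ n, (x n)⁻¹ * x (n + 1) ∈ basicNhd d n)
    (h2 : ∀ n, x (n + 1) * (x n)⁻¹ ∈ basicNhd d n) : ∃ φ, Tendsto x atTop (𝓝 φ) := by
  refine exists_tendsto_of_cauchySeq (cauchySeq_of_mem_basicNhd hd h1)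
    (cauchySeq_of_mem_basicNhd hd (x := fun n => (x n)⁻¹) fun n k hk => ?_)
  have h3 := h2 n k hk
  rw [← norm_apply_sub (x (n + 1) * (x n)⁻¹)⁻¹, inv_apply_apply_self, norm_sub_rev, mul_inv_rev] at h3
  exact h3

end StarAlgEquiv

/-! ### The canonical homomorphism `V_A → V_{A/I}` -/

namespace ApproxInner

open CStarAlgebra CStarQuotient StarAlgEquiv

variable {A : Type*} [CStarAlgebra A]

theorem conj_mem_V {u : unitary A} (hu : u ∈ unitaryComponent A) :
    Unitary.conjStarAlgAut ℂ A u ∈ V A :=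
  Subgroup.le_topologicalClosure _ ⟨u, hu, rfl⟩

theorem norm_mul_unitary (a : A) (u : unitary A) : ‖a * u‖ = ‖a‖ :=
  CStarRing.norm_mul_coe_unitary a u

theorem norm_conj_sub (u : unitary A) (a : A) :
    ‖Unitary.conjStarAlgAut ℂ A u a - a‖ = ‖a * u - u * a‖ := by
  rw [← norm_mul_unitary _ u, Unitary.conjStarAlgAut_apply, sub_mul, mul_assoc,
    Unitary.coe_star_mul_self, mul_one, norm_sub_rev]

/-- Elements of `V_A` are approximated on finite sets by inner automorphisms from `U_A`. -/
theorem exists_conj_close {φ : A ≃⋆ₐ[ℂ] A} (hφ : φ ∈ V A) (F : Finset A) {ε : ℝ} (hε : 0 < ε) :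
    ∃ u ∈ unitaryComponent A, ∀ x ∈ F, ‖Unitary.conjStarAlgAut ℂ A u x - φ x‖ < ε := by
  obtain ⟨_, h, u, hu, rfl⟩ := mem_closure_iff_nhds.1 hφ _ (setOf_close_mem_nhds φ F hε)
  exact ⟨u, hu, h⟩

variable (I : Ideal A) [I.IsTwoSided] [hI : IsClosed (I : Set A)]

theorem continuous_P : Continuous (P I) := (continuous_quotientAut I).subtype_mk _

theorem P_conj {u : unitary A} (hu : u ∈ unitaryComponent A) :
    ((P I ⟨_, conj_mem_V hu⟩ : V (A ⧸ I)) : (A ⧸ I) ≃⋆ₐ[ℂ] (A ⧸ I)) =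
      Unitary.conjStarAlgAut ℂ (A ⧸ I) (unitaryMap (mkStar I) u) := by
  ext x
  obtain ⟨a, rfl⟩ := Ideal.Quotient.mk_surjective x
  rfl

/-- Elements of `V_I` act trivially on `A/I`, as unitaries of `Ĩ` are scalars modulo `I`. -/
theorem idealV_le_ker : (idealV I).subgroupOf (V A) ≤ (P I).ker := by
  rintro ⟨φ, hφA⟩ hφ
  have key : ∀ x, φ x - x ∈ I := fun x => by
    have hcl : IsClosed {ψ : A ≃⋆ₐ[ℂ] A | ψ x - x ∈ I} :=
      hI.preimage ((StarAlgEquiv.continuous_eval x).sub continuous_const)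
    refine closure_minimal ?_ hcl hφ
    rintro _ ⟨_, ⟨u, -, rfl⟩, rfl⟩
    obtain ⟨c, hc⟩ := u.1.2
    have e1 : Ideal.Quotient.mk I ((u : unitization I) : A) =
        Ideal.Quotient.mk I (algebraMap ℂ A c) := Ideal.Quotient.eq.2 hc
    have e2 : ((u : unitization I) : A) * star ((u : unitization I) : A) = 1 :=
      congrArg Subtype.val u.2.2
    change ((u : unitization I) : A) * x * star ((u : unitization I) : A) - x ∈ I
    rw [← Ideal.Quotient.eq, map_mul, map_mul, e1, ← map_mul, Algebra.commutes, map_mul, mul_assoc,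
      ← e1, ← map_mul (Ideal.Quotient.mk I) ((u : unitization I) : A), e2, map_one, mul_one]
  refine MonoidHom.mem_ker.2 (Subtype.ext ?_)
  ext x
  obtain ⟨a, rfl⟩ := Ideal.Quotient.mk_surjective x
  exact Ideal.Quotient.eq.2 (key a)

/-- The assertion that unitaries in `U_{A/I}` that almost commute with a suitable finite set have
lifts in `U_A` that almost commute with a prescribed finite set. -/
def LiftsAlmostCommuting : Prop :=
  ∀ (F : Finset A) {ε : ℝ}, 0 < ε → ∃ (G : Finset A) (δ : ℝ), 0 < δ ∧
    ∀ u ∈ unitaryComponent (A ⧸ I), (∀ g ∈ G, ‖mkStar I g * u - u * mkStar I g‖ < δ) →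
      ∃ v ∈ unitaryComponent A, unitaryMap (mkStar I) v = u ∧ ∀ x ∈ F, ‖x * v - v * x‖ < ε

variable {I}

/-- If `φ ∈ V_A` is almost trivial on `A/I` and is approximated by `Ad(u)`, then `u` can
be replaced by `u v⁻¹`, trivial modulo `I`, where `v` almost commutes with a given finite set. -/
theorem exists_conj_close_of_P_close (h : LiftsAlmostCommuting I) (F : Finset A) {ε : ℝ}
    (hε : 0 < ε) : ∃ (G : Finset A) (δ : ℝ), 0 < δ ∧ ∀ φ : V A,
      (∀ g ∈ G, ‖(P I φ).1 (mkStar I g) - mkStar I g‖ < δ) →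
      ∃ u ∈ unitaryComponent A, ∃ v ∈ unitaryComponent A,
        unitaryMap (mkStar I) v = unitaryMap (mkStar I) u ∧
        (∀ x ∈ F, ‖Unitary.conjStarAlgAut ℂ A u x - φ.1 x‖ < ε) ∧
        ∀ x ∈ F, ‖Unitary.conjStarAlgAut ℂ A v x - x‖ < ε := by
  classical
  obtain ⟨G, δ, hδ, hlift⟩ := h F hε
  refine ⟨G, δ / 2, half_pos hδ, fun φ hφ => ?_⟩
  obtain ⟨u, hu, huφ⟩ := exists_conj_close φ.2 (F ∪ G) (lt_min hε (half_pos hδ))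
  obtain ⟨v, hv, hvu, hvF⟩ := hlift _ (unitaryMap_mem_unitaryComponent (mkStar I) hu) fun g hg => by
    rw [← norm_conj_sub]
    have h1 : ‖mkStar I (Unitary.conjStarAlgAut ℂ A u g - φ.1 g)‖ < δ / 2 :=
      (norm_mk_le I _).trans_lt
        ((huφ g (Finset.mem_union_right _ hg)).trans_le (min_le_right _ _))
    have h2 := norm_add_le (mkStar I (Unitary.conjStarAlgAut ℂ A u g - φ.1 g))
      ((P I φ).1 (mkStar I g) - mkStar I g)
    have h3 : mkStar I (Unitary.conjStarAlgAut ℂ A u g - φ.1 g) +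
        ((P I φ).1 (mkStar I g) - mkStar I g) =
        Unitary.conjStarAlgAut ℂ (A ⧸ I) (unitaryMap (mkStar I) u) (mkStar I g) - mkStar I g := by
      rw [mkStar_apply I g, P_apply_mk, map_sub, mkStar_apply I (φ.1 g), sub_add_sub_cancel]
      rfl
    rw [h3] at h2
    linarith [hφ g hg]
  refine ⟨u, hu, v, hv, hvu, fun x hx => ?_, fun x hx => ?_⟩
  · exact (huφ x (Finset.mem_union_left _ hx)).trans_le (min_le_left _ _)
  · rw [norm_conj_sub]
    exact hvF x hx

theorem ker_P (hU : ConnectedSpace (unitary (unitization I))) (h : LiftsAlmostCommuting I) :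
    (P I).ker = (idealV I).subgroupOf (V A) := by
  refine le_antisymm (fun φ hφ => ?_) (idealV_le_ker I)
  rw [Subgroup.mem_subgroupOf]
  refine mem_closure_iff_nhds.2 fun S hS => ?_
  obtain ⟨F, ε, hε, hF⟩ := exists_close_of_mem_nhds hS
  obtain ⟨G, δ, hδ, hG⟩ := exists_conj_close_of_P_close h F (half_pos hε)
  obtain ⟨u, -, v, -, huv, h1, h2⟩ := hG φ fun g _ => by
    rw [MonoidHom.mem_ker.1 hφ]
    change ‖mkStar I g - mkStar I g‖ < δ
    rwa [sub_self, norm_zero]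
  refine ⟨Unitary.conjStarAlgAut ℂ A (u * v⁻¹), hF _ fun x hx => ?_,
    ⟨_, mul_inv_mem_idealUnitaryComponent hU huv.symm, rfl⟩⟩
  have h3 : ‖Unitary.conjStarAlgAut ℂ A (u * v⁻¹) x - Unitary.conjStarAlgAut ℂ A u x‖ < ε / 2 := by
    rw [map_mul, StarAlgEquiv.mul_apply, norm_apply_sub, map_inv,
      ← norm_apply_sub (Unitary.conjStarAlgAut ℂ A v), apply_inv_apply_self, norm_sub_rev]
    exact h2 x hx
  have h4 := norm_add_le (Unitary.conjStarAlgAut ℂ A (u * v⁻¹) x - Unitary.conjStarAlgAut ℂ A u x)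
    (Unitary.conjStarAlgAut ℂ A u x - φ.1 x)
  rw [sub_add_sub_cancel] at h4
  linarith [h1 x hx]

/-- `P` is open onto its image. -/
theorem exists_small_lift_of_P_small (h : LiftsAlmostCommuting I) {S : Set (V A)}
    (hS : S ∈ 𝓝 (1 : V A)) :
    ∃ W ∈ 𝓝 (1 : V (A ⧸ I)), ∀ φ, P I φ ∈ W → ∃ ψ ∈ S, P I ψ = P I φ := by
  classical
  obtain ⟨S', hS', hSS⟩ := mem_nhds_subtype _ _ _ |>.1 hS
  obtain ⟨F, ε, hε, hF⟩ := exists_close_of_mem_nhds hS'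
  obtain ⟨G, δ, hδ, hG⟩ := exists_conj_close_of_P_close h F (half_pos hε)
  refine ⟨_, continuous_subtype_val.tendsto (1 : V (A ⧸ I))
    (setOf_close_mem_nhds 1 (G.image (mkStar I)) hδ), fun φ hφ => ?_⟩
  obtain ⟨u, hu, v, hv, huv, h1, h2⟩ := hG φ fun g hg => hφ _ (Finset.mem_image_of_mem _ hg)
  refine ⟨⟨_, conj_mem_V hv⟩ * ⟨_, conj_mem_V hu⟩⁻¹ * φ, hSS (hF _ fun x hx => ?_), ?_⟩
  · change ‖Unitary.conjStarAlgAut ℂ A v ((Unitary.conjStarAlgAut ℂ A u)⁻¹ (φ.1 x)) - x‖ < ε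
    have h3 : ‖Unitary.conjStarAlgAut ℂ A v ((Unitary.conjStarAlgAut ℂ A u)⁻¹ (φ.1 x)) -
        Unitary.conjStarAlgAut ℂ A v x‖ < ε / 2 := by
      rw [norm_apply_sub, ← norm_apply_sub (Unitary.conjStarAlgAut ℂ A u), apply_inv_apply_self,
        norm_sub_rev]
      exact h1 x hx
    have h4 := norm_add_le (Unitary.conjStarAlgAut ℂ A v ((Unitary.conjStarAlgAut ℂ A u)⁻¹ (φ.1 x)) -
        Unitary.conjStarAlgAut ℂ A v x) (Unitary.conjStarAlgAut ℂ A v x - x)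
    rw [sub_add_sub_cancel] at h4
    linarith [h2 x hx]
  · have h3 : P I ⟨_, conj_mem_V hv⟩ = P I ⟨_, conj_mem_V hu⟩ :=
      Subtype.ext (by rw [P_conj I hv, P_conj I hu, huv])
    rw [map_mul, map_mul, map_inv, h3, mul_inv_cancel, one_mul]

theorem denseRange_P : DenseRange (P I) := by
  intro φ
  refine mem_closure_iff_nhds.2 fun S hS => ?_
  obtain ⟨S', hS', hSS⟩ := mem_nhds_subtype _ _ _ |>.1 hS
  obtain ⟨_, h, u, hu, rfl⟩ := mem_closure_iff_nhds.1 φ.2 _ hS'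
  obtain ⟨v, hv, rfl⟩ := exists_lift_unitaryComponent I hu
  refine ⟨P I ⟨_, conj_mem_V hv⟩, hSS ?_, ⟨_, rfl⟩⟩
  change (P I ⟨_, conj_mem_V hv⟩ : V (A ⧸ I)).1 ∈ S'
  rw [P_conj I hv]
  exact h

theorem P_surjective [TopologicalSpace.SeparableSpace A] (h : LiftsAlmostCommuting I) :
    Function.Surjective (P I) := by
  have hd := TopologicalSpace.denseRange_denseSeq A
  set d := TopologicalSpace.denseSeq A
  have hd' : DenseRange (mkStar I ∘ d) :=
    (mkStar_surjective I).denseRange.comp hd (continuous_mkStar I)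
  refine (P I).surjective_of_denseRange_of_almost_open (continuous_P I) denseRange_P
    (fun S hS => exists_small_lift_of_P_small h hS)
    ⟨fun n => Subtype.val ⁻¹' basicNhd d n, fun n =>
      continuous_subtype_val.tendsto (1 : V A) (basicNhd_mem_nhds d n), fun x hx => ?_⟩
    ⟨fun n => Subtype.val ⁻¹' basicNhd (mkStar I ∘ d) n, fun n =>
      continuous_subtype_val.tendsto (1 : V (A ⧸ I)) (basicNhd_mem_nhds _ n), fun y hy => ?_⟩
  · obtain ⟨φ, hφ⟩ := exists_tendsto_of_mem_basicNhd hd (x := fun n => (x n).1)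
      (fun n => (hx n).1) (fun n => (hx n).2)
    have hφV : φ ∈ V A := (Subgroup.isClosed_topologicalClosure _).mem_of_tendsto hφ
      (Eventually.of_forall fun n => (x n).2)
    exact ⟨⟨φ, hφV⟩, tendsto_subtype_rng.2 hφ⟩
  · exact tendsto_subtype_rng.2 (tendsto_one_of_mem_basicNhd hd' hy)

theorem exists_isEmbedding (hU : ConnectedSpace (unitary (unitization I)))
    (h : LiftsAlmostCommuting I) :
    ∃ Pt : V A ⧸ (idealV I).subgroupOf (V A) →* V (A ⧸ I),
      P I = Pt.comp (QuotientGroup.mk' _) ∧ IsEmbedding Pt := by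
  have hker := ker_P hU h
  refine ⟨QuotientGroup.lift _ (P I) hker.ge, (QuotientGroup.lift_comp_mk' _ _ hker.ge).symm, ?_, ?_⟩
  · have hcont : Continuous (QuotientGroup.lift _ (P I) hker.ge) :=
      (QuotientGroup.isQuotientMap_mk _).continuous_iff.2 (continuous_P I)
    refine IsTopologicalGroup.isInducing_iff_nhds_one.2 (le_antisymm ?_ fun S hS => ?_)
    · have := hcont.tendsto 1
      rw [map_one] at this
      exact this.le_comap
    · have hS' : QuotientGroup.mk ⁻¹' S ∈ 𝓝 (1 : V A) :=
        QuotientGroup.continuous_mk.tendsto (1 : V A) hS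
      obtain ⟨W, hW, hWS⟩ := exists_small_lift_of_P_small h hS'
      refine ⟨W, hW, fun q hq => ?_⟩
      obtain ⟨φ, rfl⟩ := QuotientGroup.mk_surjective q
      obtain ⟨ψ, hψ, hψφ⟩ := hWS φ hq
      have : (QuotientGroup.mk ψ : V A ⧸ (idealV I).subgroupOf (V A)) = QuotientGroup.mk φ := by
        rw [QuotientGroup.eq, ← hker, MonoidHom.mem_ker, map_mul, map_inv, hψφ, inv_mul_cancel]
      exact this ▸ hψ
  · rw [injective_iff_map_eq_one]
    intro q hq
    obtain ⟨φ, rfl⟩ := QuotientGroup.mk_surjective q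
    rw [QuotientGroup.eq_one_iff, ← hker]
    exact hq

end ApproxInner

end

theorem theorem1p2 {A : Type*} [CStarAlgebra A] [TopologicalSpace.SeparableSpace A]
    (ω : Ultrafilter ℕ) (hω : (ω : Filter ℕ) ≤ Filter.cofinite)
    (I : Ideal A) [I.IsTwoSided] [IsClosed (I : Set A)] (hI : I ≠ ⊤)
    (hU : ConnectedSpace (unitary (ApproxInner.unitization I)))
    (h : ApproxInner.HasStableRankOne (ApproxInner.centralSequenceAlgebra ω A) ∨
      ConnectedSpace (unitary (ApproxInner.centralSequenceAlgebra ω (A ⧸ I)))) :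
    (ApproxInner.P I).ker = (ApproxInner.idealV I).subgroupOf (ApproxInner.V A) ∧
    (∃ Pt : ApproxInner.V A ⧸ (ApproxInner.idealV I).subgroupOf (ApproxInner.V A) →*
        ApproxInner.V (A ⧸ I),
      ApproxInner.P I = Pt.comp (QuotientGroup.mk' _) ∧ Topology.IsEmbedding Pt) ∧
    Function.Surjective (ApproxInner.P I) := by
  have hlift : ApproxInner.LiftsAlmostCommuting I := fun F _ hε =>
    ApproxInner.exists_lift_almost_commuting I hω hU
      (ApproxInner.unitaryMap_centralMap_surjective ω I hω h) F hε
  exact ⟨ApproxInner.ker_P hU hlift, ApproxInner.exists_isEmbedding hU hlift,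
    ApproxInner.P_surjective hlift⟩
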